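/- For $t>0$ let $t'$ be the conjugate exponent, defined by $1/t+1/t'=1$ (so $t'<0$ when $t<1$, and $1'=\infty$), and let $$C_t=\Bigl(\frac{t^{1/t}}{|t'|^{1/t'}}\Bigr)^{1/2},\qquad C_1=1 .$$ For non-negative measurable functions $f,g$ on $\mathbb R^N$ let $(f*g)(x)=\int_{\mathbb R^N} f(y)\,g(x-y)\,dy\in[0,\infty]$, and for $0<s<\infty$ let $\|h\|_s=\bigl(\int_{\mathbb R^N}|h|^s\bigr)^{1/s}\in[0,\infty]$. **Theorem.** Let $0<p,q,r<\infty$ satisfy $1/p+1/q=1+1/r$. 1. If $p,q,r\ge 1$, then for all non-negative $f\in L^p(\mathbb R^N)$ and $g\in L^q(\mathbb R^N)$, $$\|f*g\|_r\le\Bigl(\frac{C_pC_q}{C_r}\Bigr)^N\|f\|_p\,\|g\|_q .$$ Moreover, the constant is optimal: if $K\in[0,\infty]$ and $\|f*g\|_r\le K\|f\|_p\|g\|_q$ for all such $f,g$, then $K\ge (C_pC_q/C_r)^N$. 2. If $p,q,r\le 1$, then for all non-negative $f\in L^p(\mathbb R^N)$ and $g\in L^q(\mathbb R^N)$, $$\|f*g\|_r\ge\Bigl(\frac{C_pC_q}{C_r}\Bigr)^N\|f\|_p\,\|g\|_q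 .$$ Moreover, the constant is optimal: if $K\in[0,\infty]$ and $\|f*g\|_r\ge K\|f\|_p\|g\|_q$ for all such $f,g$, then $K\le (C_pC_q/C_r)^N$. -/

import Mathlib

open MeasureTheory
open scoped ENNReal

noncomputable section

/-- The constant `C_t = (t^(1/t) / |t'|^(1/t'))^(1/2)`, where `t' = t / (t - 1)` is the conjugate
exponent, `1/t + 1/t' = 1` (negative when `t < 1`). At `t = 1`, where `t' = ∞`, the factor
`|t'|^(1/t')` is read as its limit `1`; the formula gives this value, see `youngConst_one`. -/
def youngConst (t : ℝ) : ℝ :=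
  Real.sqrt (t ^ (1 / t) / |t.conjExponent| ^ (1 / t.conjExponent))

theorem youngConst_one : youngConst 1 = 1 := by
  simp [youngConst, Real.conjExponent]

/-- The constant `(C_p C_q / C_r)^N`. -/
def sharpYoungConst (N : ℕ) (p q r : ℝ) : ℝ≥0∞ :=
  ENNReal.ofReal ((youngConst p * youngConst q / youngConst r) ^ N)

/-- The convolution `(f ∗ g)(x) = ∫ f(y) g(x - y) dy` of two non-negative functions on `ℝ^N`, with
values in `[0, ∞]`. It may be infinite when the exponents are less than one. -/
def nonnegConv {N : ℕ} (f g : EuclideanSpace ℝ (Fin N) → ℝ) :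
    EuclideanSpace ℝ (Fin N) → ℝ≥0∞ :=
  fun x => ∫⁻ y, ENNReal.ofReal (f y) * ENNReal.ofReal (g (x - y))

/-- `‖f ∗ g‖_r ≤ K ‖f‖_p ‖g‖_q` for all non-negative `f ∈ L^p(ℝ^N)`, `g ∈ L^q(ℝ^N)`. -/
def YoungIneq (N : ℕ) (p q r : ℝ) (K : ℝ≥0∞) : Prop :=
  ∀ f g : EuclideanSpace ℝ (Fin N) → ℝ,
    MemLp f (ENNReal.ofReal p) volume → MemLp g (ENNReal.ofReal q) volume →
    (∀ᵐ x, 0 ≤ f x) → (∀ᵐ x, 0 ≤ g x) →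
    eLpNorm (nonnegConv f g) (ENNReal.ofReal r) volume ≤
      K * (eLpNorm f (ENNReal.ofReal p) volume * eLpNorm g (ENNReal.ofReal q) volume)

/-- `‖f ∗ g‖_r ≥ K ‖f‖_p ‖g‖_q` for all non-negative `f ∈ L^p(ℝ^N)`, `g ∈ L^q(ℝ^N)`. -/
def ReverseYoungIneq (N : ℕ) (p q r : ℝ) (K : ℝ≥0∞) : Prop :=
  ∀ f g : EuclideanSpace ℝ (Fin N) → ℝ,
    MemLp f (ENNReal.ofReal p) volume → MemLp g (ENNReal.ofReal q) volume →
    (∀ᵐ x, 0 ≤ f x) → (∀ᵐ x, 0 ≤ g x) →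
    K * (eLpNorm f (ENNReal.ofReal p) volume * eLpNorm g (ENNReal.ofReal q) volume) ≤
      eLpNorm (nonnegConv f g) (ENNReal.ofReal r) volume

end

/-! The sharp constant is multiplicative in the dimension. Slicing a product space and applying
Minkowski's integral inequality in `L^r` (reversed when `r ≤ 1`, see `lintegral_lnorm_le`) shows
that constants on two factors multiply. So everything reduces to the line: `LYoung.prod`,
`LYoungReverse.prod`.

On the line both directions follow from one comparison, Barthe's `lintegral_le_of_transport`. Given
densities `F`, `f` of equal mass and `G`, `g` of equal mass, let `u` and `v` be the increasing maps
carrying `F` to `f` and `G` to `g`, so that `u' = F / f(u)` and `v' = G / g(v)`. After the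
substitution `a = u(l t + σ)`, `b = v((1 - l) t - σ)`, Hölder's inequality in `t` separates a factor
containing only `F` and `G` from one containing `H`. The second factor is at most the norm of `H`:
the arithmetic-geometric mean inequality gives `u'^l v'^(1-l) ≤ l u' + (1 - l) v'`, which is the
derivative in `t` of the argument of `H`.

Taking `F`, `G` Gaussian and `f^p`, `g^q` as targets bounds `∫ (f * g) H`, which is Young's
inequality by duality. Taking the targets and `H` Gaussian, with exponents `p/r`, `q/r`, `1/r`,
bounds `∫ (φ * ψ)^r` from below, which is the reverse inequality. In both cases the constant is the
ratio `gaussRatio` attained by Gaussians, and `gaussRatio_eq_youngConst` identifies it with `C_p C_q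
/ C_r`. The cases `p = 1` and `q = 1` are Minkowski's inequality.

Optimality is tested on Gaussians: they attain the constant if `p, q ≠ 1` and approach it in a limit
otherwise. -/

/-- The `L^p` norm `(∫ f^p)^(1/p)` of a function with values in `[0, ∞]`. -/
noncomputable def lnorm {α : Type*} [MeasureSpace α] (p : ℝ) (f : α → ℝ≥0∞) : ℝ≥0∞ :=
  (∫⁻ x, f x ^ p) ^ (1 / p)

/-- The convolution of two functions with values in `[0, ∞]`. -/
noncomputable def nconv {α : Type*} [MeasureSpace α] [AddGroup α] (f g : α → ℝ≥0∞) (x : α) :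
    ℝ≥0∞ :=
  ∫⁻ y, f y * g (x - y)

/-! ### Norms of `[0, ∞]`-valued functions, duality and Minkowski's inequality -/

section Lnorm

variable {α β : Type*} [MeasureSpace α] [MeasureSpace β]

theorem lnorm_rpow {p : ℝ} (hp : 0 < p) (f : α → ℝ≥0∞) : lnorm p f ^ p = ∫⁻ x, f x ^ p := by
  rw [lnorm, ← ENNReal.rpow_mul, one_div_mul_cancel hp.ne', ENNReal.rpow_one]

theorem lnorm_mono {p : ℝ} (hp : 0 < p) {f g : α → ℝ≥0∞} (h : ∀ x, f x ≤ g x) :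
    lnorm p f ≤ lnorm p g := by
  unfold lnorm
  gcongr with x
  exact h x

theorem lnorm_const_mul {p : ℝ} (hp : 0 < p) (c : ℝ≥0∞) {f : α → ℝ≥0∞} (hf : Measurable f) :
    lnorm p (fun x => c * f x) = c * lnorm p f := by
  unfold lnorm
  simp_rw [ENNReal.mul_rpow_of_nonneg _ _ hp.le]
  rw [lintegral_const_mul _ (hf.pow_const p), ENNReal.mul_rpow_of_nonneg _ _ (by positivity),
    ← ENNReal.rpow_mul, mul_one_div_cancel hp.ne', ENNReal.rpow_one]

theorem lnorm_comp {p : ℝ} {e : α → β} (he : MeasurePreserving e) {f : β → ℝ≥0∞}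
    (hf : Measurable f) : lnorm p (fun x => f (e x)) = lnorm p f := by
  unfold lnorm
  rw [he.lintegral_comp (f := fun y => f y ^ p) (hf.pow_const p)]

theorem measurable_lnorm_left [SFinite (volume : Measure β)] {p : ℝ} {f : α × β → ℝ≥0∞}
    (hf : Measurable f) : Measurable fun x => lnorm p fun y => f (x, y) :=
  ((hf.pow_const p).lintegral_prod_right').pow_const _

theorem lnorm_prod [SFinite (volume : Measure α)] [SFinite (volume : Measure β)] {p : ℝ}
    (hp : 0 < p) {f : α × β → ℝ≥0∞} (hf : Measurable f) :
    lnorm p f = lnorm p fun x => lnorm p fun y => f (x, y) := by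
  conv_rhs => rw [lnorm]
  simp_rw [lnorm_rpow hp]
  rw [lnorm, Measure.volume_eq_prod, lintegral_prod _ (hf.pow_const p).aemeasurable]

/-- Any measurable function can be approximated from below, in integral, by measurable functions
with finite integral. -/
theorem exists_le_lt_lintegral [SigmaFinite (volume : Measure α)] (f : α → ℝ≥0∞) {L : ℝ≥0∞}
    (hL : L < ∫⁻ x, f x) :
    ∃ g : α → ℝ≥0∞, Measurable g ∧ (∀ x, g x ≤ f x) ∧ ∫⁻ x, g x < ∞ ∧ L < ∫⁻ x, g x := by
  rw [lintegral_eq_nnreal] at hL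
  simp_rw [lt_iSup_iff] at hL
  obtain ⟨φ, hφ, hLφ⟩ := hL
  rw [← SimpleFunc.lintegral_eq_lintegral] at hLφ
  obtain ⟨g, hg, hfin, hlt⟩ := SimpleFunc.exists_lt_lintegral_simpleFunc_of_lt_lintegral
    (f := φ) (L := L) (by simpa using hLφ)
  exact ⟨fun x => g x, by fun_prop,
    fun x => (ENNReal.coe_le_coe.2 (hg x)).trans (hφ x), hfin, hlt⟩

/-- The converse of Hölder's inequality. -/
theorem lnorm_le_of_forall_lintegral_mul_le [SigmaFinite (volume : Measure α)] {r s : ℝ}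
    (hrs : r.HolderConjugate s) {ψ : α → ℝ≥0∞} {C : ℝ≥0∞}
    (h : ∀ φ : α → ℝ≥0∞, Measurable φ → ∫⁻ x, ψ x * φ x ≤ C * lnorm s φ) :
    lnorm r ψ ≤ C := by
  have hr := hrs.pos
  have hs := hrs.symm.pos
  rw [lnorm, one_div, ENNReal.rpow_inv_le_iff hr]
  refine le_of_forall_lt fun L hL => ?_
  obtain ⟨g, hgm, hgle, hfin, hlt⟩ := exists_le_lt_lintegral _ hL
  refine hlt.trans_le ?_
  have h0 : ∫⁻ x, g x ≠ 0 := (zero_le.trans_lt hlt).ne'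
  -- The test function is `g ^ (1 / s)` with `g ≤ ψ ^ r`; the finite integral of `g` is what allows
  -- division by its power `1 / s`.
  have key : ∫⁻ x, g x ≤ C * (∫⁻ x, g x) ^ (1 / s) := by
    calc ∫⁻ x, g x = ∫⁻ x, g x ^ (1 / r) * g x ^ (1 / s) := by
          refine lintegral_congr fun x => ?_
          rw [← ENNReal.rpow_add_of_nonneg _ _ (by positivity) (by positivity), one_div, one_div,
            hrs.inv_add_inv_eq_one, ENNReal.rpow_one]
      _ ≤ ∫⁻ x, ψ x * g x ^ (1 / s) := by
          gcongr with x
          rw [one_div, ENNReal.rpow_inv_le_iff hr]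
          exact hgle x
      _ ≤ C * lnorm s fun x => g x ^ (1 / s) := h _ (hgm.pow_const _)
      _ = C * (∫⁻ x, g x) ^ (1 / s) := by
          simp_rw [lnorm, ← ENNReal.rpow_mul, one_div_mul_cancel hs.ne', ENNReal.rpow_one]
  rw [← ENNReal.rpow_inv_le_iff hr]
  have hs0 : (∫⁻ x, g x) ^ (1 / s) ≠ 0 := by
    simp [ENNReal.rpow_eq_zero_iff, h0, hfin.ne]
  have hst : (∫⁻ x, g x) ^ (1 / s) ≠ ∞ := ENNReal.rpow_ne_top_of_nonneg (by positivity) hfin.ne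
  rw [← ENNReal.mul_le_mul_iff_left hs0 hst]
  refine le_trans (le_of_eq ?_) key
  rw [← ENNReal.rpow_add _ _ h0 hfin.ne, one_div, hrs.inv_add_inv_eq_one, ENNReal.rpow_one]

theorem lintegral_mul_le_lnorm_mul_lnorm {r s : ℝ} (hrs : r.HolderConjugate s) {f g : α → ℝ≥0∞}
    (hf : Measurable f) (hg : Measurable g) : ∫⁻ x, f x * g x ≤ lnorm r f * lnorm s g :=
  ENNReal.lintegral_mul_le_Lp_mul_Lq volume hrs hf.aemeasurable hg.aemeasurable

/-- Minkowski's integral inequality. -/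
theorem lnorm_lintegral_le [SigmaFinite (volume : Measure α)] [SigmaFinite (volume : Measure β)]
    {r : ℝ} (hr : 1 ≤ r) {φ : α × β → ℝ≥0∞} (hφ : Measurable φ) :
    lnorm r (fun y => ∫⁻ x, φ (x, y)) ≤ ∫⁻ x, lnorm r fun y => φ (x, y) := by
  rcases hr.eq_or_lt with rfl | hr
  · simp only [lnorm, ENNReal.rpow_one, one_div_one]
    rw [lintegral_lintegral_swap]
    exact (hφ.comp measurable_swap).aemeasurable
  · have hrs := Real.HolderConjugate.conjExponent hr
    refine lnorm_le_of_forall_lintegral_mul_le hrs fun ψ hψ => ?_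
    calc ∫⁻ y, (∫⁻ x, φ (x, y)) * ψ y = ∫⁻ y, ∫⁻ x, φ (x, y) * ψ y := by
          refine lintegral_congr fun y => ?_
          rw [lintegral_mul_const _ (by fun_prop)]
      _ = ∫⁻ x, ∫⁻ y, φ (x, y) * ψ y := by
          rw [lintegral_lintegral_swap]
          exact Measurable.aemeasurable (by fun_prop)
      _ ≤ ∫⁻ x, (lnorm r fun y => φ (x, y)) * lnorm r.conjExponent ψ := by
          gcongr with x
          exact lintegral_mul_le_lnorm_mul_lnorm hrs (by fun_prop) hψ
      _ = _ := lintegral_mul_const _ (measurable_lnorm_left hφ)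

/-- Minkowski's integral inequality is reversed for exponents at most one. -/
theorem lintegral_lnorm_le [SigmaFinite (volume : Measure α)] [SigmaFinite (volume : Measure β)]
    {r : ℝ} (hr0 : 0 < r) (hr : r ≤ 1) {φ : α × β → ℝ≥0∞} (hφ : Measurable φ) :
    ∫⁻ x, (lnorm r fun y => φ (x, y)) ≤ lnorm r (fun y => ∫⁻ x, φ (x, y)) := by
  rcases hr.eq_or_lt with rfl | hr
  · simp only [lnorm, ENNReal.rpow_one, one_div_one]
    rw [lintegral_lintegral_swap]
    exact hφ.aemeasurable
  set ψ : β → ℝ≥0∞ := fun y => ∫⁻ x, φ (x, y) with hψdef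
  have hψ : Measurable ψ := hφ.lintegral_prod_left'
  set J := ∫⁻ y, ψ y ^ r with hJ
  by_cases hJtop : J = ∞
  · rw [lnorm, ← hJ, hJtop, ENNReal.top_rpow_of_pos (by positivity)]
    exact le_top
  have hfin : ∀ᵐ y, ψ y ≠ ∞ := by
    filter_upwards [ae_lt_top (hψ.pow_const r) hJtop] with y hy h
    simp [h, hr0] at hy
  -- The weight `ψ ^ (r - 1)` used below is infinite where `ψ = 0`, so `φ` must be known to vanish
  -- there.
  have hzero : ∀ᵐ x, ∀ᵐ y, ψ y = 0 → φ (x, y) = 0 := by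
    have hmeas : MeasurableSet {z : α × β | ψ z.2 = 0 → φ z = 0} := by
      have h1 : MeasurableSet {z : α × β | ψ z.2 = 0} :=
        (hψ.comp measurable_snd) (measurableSet_singleton 0)
      have h2 : MeasurableSet {z : α × β | φ z = 0} := hφ (measurableSet_singleton 0)
      exact h1.imp h2
    have hae : ∀ᵐ y, ∀ᵐ x, ψ y = 0 → φ (x, y) = 0 := by
      refine Filter.Eventually.of_forall fun y => ?_
      by_cases hy : ψ y = 0
      · filter_upwards [(lintegral_eq_zero_iff (by fun_prop)).1 hy] with x hx _ using hx
      · simp [hy]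
    exact Measure.ae_ae_of_ae_prod
      ((Measure.ae_prod_iff_ae_ae hmeas).2 ((Measure.ae_ae_comm hmeas).2 hae))
  have h1r : 0 < 1 - r := by linarith
  -- Hölder with exponents `1 / r` and `1 / (1 - r)`, applied to `φ ^ r = (φ ψ ^ (r - 1)) ^ r · ψ ^
  -- (r (1 - r))`. The bound is now linear in `φ`, so integrating over `x` turns `φ` into `ψ`.
  have hx : ∀ᵐ x, (lnorm r fun y => φ (x, y)) ≤
      (∫⁻ y, φ (x, y) * ψ y ^ (r - 1)) * J ^ ((1 - r) / r) := by
    filter_upwards [hzero] with x hx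
    have hst : (1 / r).HolderConjugate (1 / (1 - r)) := by
      refine ⟨?_, by positivity, by positivity⟩
      simp
    have h1 : ∫⁻ y, φ (x, y) ^ r ≤
        (∫⁻ y, φ (x, y) * ψ y ^ (r - 1)) ^ r * J ^ (1 - r) := by
      calc ∫⁻ y, φ (x, y) ^ r
          ≤ ∫⁻ y, (φ (x, y) * ψ y ^ (r - 1)) ^ r * ψ y ^ (r * (1 - r)) := by
            refine lintegral_mono_ae ?_
            filter_upwards [hx, hfin] with y hy hyt
            by_cases h0 : ψ y = 0
            · simp [hy h0, hr0]
            · rw [ENNReal.mul_rpow_of_nonneg _ _ hr0.le, ← ENNReal.rpow_mul, mul_assoc,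
                ← ENNReal.rpow_add _ _ h0 hyt]
              ring_nf
              simp
        _ ≤ _ := by
            refine (lintegral_mul_le_lnorm_mul_lnorm hst (by fun_prop) (by fun_prop)).trans_eq ?_
            simp_rw [lnorm, ← ENNReal.rpow_mul]
            rw [hJ]
            congr 2
            · simp [hr0.ne']
            · simp
            · refine lintegral_congr fun y => ?_
              congr 1
              field_simp
            · simp
    calc lnorm r (fun y => φ (x, y))
        ≤ ((∫⁻ y, φ (x, y) * ψ y ^ (r - 1)) ^ r * J ^ (1 - r)) ^ (1 / r) := by
          unfold lnorm; gcongr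
      _ = _ := by
          rw [ENNReal.mul_rpow_of_nonneg _ _ (by positivity), ← ENNReal.rpow_mul,
            ← ENNReal.rpow_mul, mul_one_div_cancel hr0.ne', ENNReal.rpow_one]
          congr 2
          field_simp
  calc ∫⁻ x, (lnorm r fun y => φ (x, y))
      ≤ ∫⁻ x, (∫⁻ y, φ (x, y) * ψ y ^ (r - 1)) * J ^ ((1 - r) / r) := lintegral_mono_ae hx
    _ = (∫⁻ x, ∫⁻ y, φ (x, y) * ψ y ^ (r - 1)) * J ^ ((1 - r) / r) := by
        rw [lintegral_mul_const]
        exact Measurable.lintegral_prod_right' (f := fun z : α × β => φ z * ψ z.2 ^ (r - 1))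
          (by fun_prop)
    _ = (∫⁻ y, ψ y * ψ y ^ (r - 1)) * J ^ ((1 - r) / r) := by
        congr 1
        rw [lintegral_lintegral_swap (Measurable.aemeasurable (by fun_prop))]
        refine lintegral_congr fun y => ?_
        rw [lintegral_mul_const _ (by fun_prop)]
    _ ≤ J * J ^ ((1 - r) / r) := by
        gcongr
        refine lintegral_mono_ae ?_
        filter_upwards [hfin] with y hy
        by_cases h0 : ψ y = 0
        · simp [h0]
        · nth_rewrite 1 [← ENNReal.rpow_one (ψ y)]
          rw [← ENNReal.rpow_add _ _ h0 hy]
          simp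
    _ ≤ lnorm r ψ := by
        rw [lnorm, ← hJ]
        by_cases h0 : J = 0
        · simp [h0]
        · nth_rewrite 1 [← ENNReal.rpow_one J]
          rw [← ENNReal.rpow_add _ _ h0 hJtop]
          apply le_of_eq
          congr 1
          field_simp
          ring

end Lnorm

/-! ### Convolution inequalities on products -/

/-- Young's convolution inequality with constant `C`. -/
def LYoung (α : Type*) [MeasureSpace α] [AddGroup α] (p q r : ℝ) (C : ℝ≥0∞) : Prop :=
  ∀ f g : α → ℝ≥0∞, Measurable f → Measurable g →
    lnorm r (nconv f g) ≤ C * (lnorm p f * lnorm q g)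

/-- The reverse of Young's convolution inequality with constant `C`. -/
def LYoungReverse (α : Type*) [MeasureSpace α] [AddGroup α] (p q r : ℝ) (C : ℝ≥0∞) : Prop :=
  ∀ f g : α → ℝ≥0∞, Measurable f → Measurable g →
    C * (lnorm p f * lnorm q g) ≤ lnorm r (nconv f g)

section Convolution

instance Prod.instMeasurableSubTwo {α β : Type*} [MeasurableSpace α] [MeasurableSpace β] [Sub α]
    [Sub β] [MeasurableSub₂ α] [MeasurableSub₂ β] : MeasurableSub₂ (α × β) :=
  ⟨by
    refine Measurable.prodMk ?_ ?_
    · exact (measurable_fst.comp measurable_fst).sub (measurable_fst.comp measurable_snd)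
    · exact (measurable_snd.comp measurable_fst).sub (measurable_snd.comp measurable_snd)⟩

variable {α β : Type*} [MeasureSpace α] [MeasureSpace β] [AddGroup α] [AddGroup β]

theorem nconv_comp {e : α → β} (he : MeasurePreserving e) (hsub : ∀ x y, e (x - y) = e x - e y)
    {f g : β → ℝ≥0∞} (h : ∀ x, Measurable fun y => f y * g (x - y)) (x : α) :
    nconv (fun z => f (e z)) (fun z => g (e z)) x = nconv f g (e x) := by
  unfold nconv
  simp_rw [hsub]
  exact he.lintegral_comp (h _)

variable [MeasurableSub₂ β] [SigmaFinite (volume : Measure β)]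

theorem measurable_nconv {f g : β → ℝ≥0∞} (hf : Measurable f) (hg : Measurable g) :
    Measurable (nconv f g) :=
  Measurable.lintegral_prod_right' (f := fun z : β × β => f z.2 * g (z.1 - z.2)) (by fun_prop)

theorem LYoung.of_equiv {p q r : ℝ} {C : ℝ≥0∞} (e : α ≃ᵐ β) (he : MeasurePreserving e)
    (hsub : ∀ x y, e (x - y) = e x - e y) (h : LYoung β p q r C) : LYoung α p q r C := by
  intro f g hf hg
  have hf' : Measurable fun x => f (e.symm x) := by fun_prop
  have hg' : Measurable fun x => g (e.symm x) := by fun_prop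
  have := h _ _ hf' hg'
  rw [← lnorm_comp he (measurable_nconv hf' hg'), ← lnorm_comp he hf', ← lnorm_comp he hg'] at this
  simp_rw [← nconv_comp he hsub (f := fun x => f (e.symm x)) (g := fun x => g (e.symm x))
    (fun x => by fun_prop)] at this
  simpa using this

theorem LYoungReverse.of_equiv {p q r : ℝ} {C : ℝ≥0∞} (e : α ≃ᵐ β) (he : MeasurePreserving e)
    (hsub : ∀ x y, e (x - y) = e x - e y) (h : LYoungReverse β p q r C) :
    LYoungReverse α p q r C := by
  intro f g hf hg
  have hf' : Measurable fun x => f (e.symm x) := by fun_prop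
  have hg' : Measurable fun x => g (e.symm x) := by fun_prop
  have := h _ _ hf' hg'
  rw [← lnorm_comp he (measurable_nconv hf' hg'), ← lnorm_comp he hf', ← lnorm_comp he hg'] at this
  simp_rw [← nconv_comp he hsub (f := fun x => f (e.symm x)) (g := fun x => g (e.symm x))
    (fun x => by fun_prop)] at this
  simpa using this

variable [MeasurableSub₂ α]

theorem nconv_prod {f g : α × β → ℝ≥0∞} (hf : Measurable f) (hg : Measurable g) (x : α × β) :
    nconv f g x =
      ∫⁻ y, nconv (fun z => f (y, z)) (fun z => g (x.1 - y, z)) x.2 := by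
  unfold nconv
  rw [Measure.volume_eq_prod, lintegral_prod _ (Measurable.aemeasurable (by fun_prop))]
  rfl

theorem measurable_nconv_slices {f g : α × β → ℝ≥0∞} (hf : Measurable f) (hg : Measurable g)
    (x : α) : Measurable fun z : α × β =>
      nconv (fun w => f (z.1, w)) (fun w => g (x - z.1, w)) z.2 :=
  Measurable.lintegral_prod_right'
    (f := fun z : (α × β) × β => f (z.1.1, z.2) * g (x - z.1.1, z.1.2 - z.2)) (by fun_prop)

variable [SigmaFinite (volume : Measure α)]

/-- A convolution on the product is an integral over `y` of convolutions of slices. Minkowski moves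
the inner `L^r` norm under that integral, the inequality on `β` bounds each slice, and what remains
is a convolution on `α` of the slice norms. The hypothesis `1 ≤ r` is there for Minkowski. -/
theorem LYoung.prod {p q r : ℝ} {A B : ℝ≥0∞} (hp : 0 < p) (hq : 0 < q) (hr : 1 ≤ r)
    (hα : LYoung α p q r A) (hβ : LYoung β p q r B) : LYoung (α × β) p q r (A * B) := by
  intro f g hf hg
  have hr0 : 0 < r := by linarith
  have hF := measurable_lnorm_left (p := p) hf
  have hG := measurable_lnorm_left (p := q) hg
  rw [lnorm_prod hr0 (measurable_nconv hf hg), lnorm_prod hp hf, lnorm_prod hq hg]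
  calc lnorm r (fun x => lnorm r fun z => nconv f g (x, z))
      ≤ lnorm r (fun x => B * nconv (fun y => lnorm p fun z => f (y, z))
          (fun y => lnorm q fun z => g (y, z)) x) := by
        refine lnorm_mono hr0 fun x => ?_
        simp_rw [nconv_prod hf hg]
        refine (lnorm_lintegral_le hr (measurable_nconv_slices hf hg x)).trans ?_
        have hFG : Measurable fun y => (lnorm p fun z => f (y, z)) * lnorm q fun z => g (x - y, z) :=
          hF.mul (hG.comp (measurable_const.sub measurable_id))
        rw [nconv, ← lintegral_const_mul _ hFG]
        gcongr with y
        exact hβ _ _ (by fun_prop) (by fun_prop)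
    _ = B * lnorm r (nconv (fun y => lnorm p fun z => f (y, z))
          (fun y => lnorm q fun z => g (y, z))) := lnorm_const_mul hr0 _ (measurable_nconv hF hG)
    _ ≤ B * (A * (lnorm p (fun y => lnorm p fun z => f (y, z)) *
          lnorm q (fun y => lnorm q fun z => g (y, z)))) := by
        gcongr
        exact hα _ _ hF hG
    _ = _ := by ring

theorem LYoungReverse.prod {p q r : ℝ} {A B : ℝ≥0∞} (hp : 0 < p) (hq : 0 < q) (hr0 : 0 < r)
    (hr : r ≤ 1) (hα : LYoungReverse α p q r A) (hβ : LYoungReverse β p q r B) :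
    LYoungReverse (α × β) p q r (A * B) := by
  intro f g hf hg
  have hF := measurable_lnorm_left (p := p) hf
  have hG := measurable_lnorm_left (p := q) hg
  rw [lnorm_prod hr0 (measurable_nconv hf hg), lnorm_prod hp hf, lnorm_prod hq hg]
  calc A * B * (lnorm p (fun y => lnorm p fun z => f (y, z)) *
          lnorm q (fun y => lnorm q fun z => g (y, z)))
      = B * (A * (lnorm p (fun y => lnorm p fun z => f (y, z)) *
          lnorm q (fun y => lnorm q fun z => g (y, z)))) := by ring
    _ ≤ B * lnorm r (nconv (fun y => lnorm p fun z => f (y, z))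
          (fun y => lnorm q fun z => g (y, z))) := by
        gcongr
        exact hα _ _ hF hG
    _ = lnorm r (fun x => B * nconv (fun y => lnorm p fun z => f (y, z))
          (fun y => lnorm q fun z => g (y, z)) x) :=
        (lnorm_const_mul hr0 _ (measurable_nconv hF hG)).symm
    _ ≤ lnorm r (fun x => lnorm r fun z => nconv f g (x, z)) := by
        refine lnorm_mono hr0 fun x => ?_
        simp_rw [nconv_prod hf hg]
        refine le_trans ?_ (lintegral_lnorm_le hr0 hr (measurable_nconv_slices hf hg x))
        have hFG : Measurable fun y => (lnorm p fun z => f (y, z)) * lnorm q fun z => g (x - y, z) :=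
          hF.mul (hG.comp (measurable_const.sub measurable_id))
        rw [nconv, ← lintegral_const_mul _ hFG]
        gcongr with y
        exact hβ _ _ (by fun_prop) (by fun_prop)

end Convolution

theorem lintegral_fin_zero (f : (Fin 0 → ℝ) → ℝ≥0∞) : ∫⁻ x, f x = f default := by
  rw [Measure.volume_pi_eq_dirac default, lintegral_dirac]

theorem lnorm_fin_zero {p : ℝ} (hp : 0 < p) (f : (Fin 0 → ℝ) → ℝ≥0∞) :
    lnorm p f = f default := by
  rw [lnorm, lintegral_fin_zero, ← ENNReal.rpow_mul, mul_one_div_cancel hp.ne', ENNReal.rpow_one]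

theorem nconv_fin_zero (f g : (Fin 0 → ℝ) → ℝ≥0∞) (x : Fin 0 → ℝ) :
    nconv f g x = f default * g default := by
  rw [nconv, lintegral_fin_zero, Subsingleton.elim (x - default) default]

theorem LYoung.pi {p q r : ℝ} {C : ℝ≥0∞} (hp : 0 < p) (hq : 0 < q) (hr : 1 ≤ r)
    (h : LYoung ℝ p q r C) (n : ℕ) : LYoung (Fin n → ℝ) p q r (C ^ n) := by
  induction n with
  | zero =>
    intro f g _ _
    rw [lnorm_fin_zero (zero_lt_one.trans_le hr), lnorm_fin_zero hp, lnorm_fin_zero hq,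
      nconv_fin_zero, pow_zero, one_mul]
  | succ n ih =>
    rw [pow_succ']
    exact (h.prod hp hq hr ih).of_equiv (MeasurableEquiv.piFinSuccAbove (fun _ => ℝ) 0)
      (volume_preserving_piFinSuccAbove (fun _ => ℝ) 0) (fun _ _ => rfl)

theorem LYoungReverse.pi {p q r : ℝ} {C : ℝ≥0∞} (hp : 0 < p) (hq : 0 < q) (hr0 : 0 < r)
    (hr : r ≤ 1) (h : LYoungReverse ℝ p q r C) (n : ℕ) :
    LYoungReverse (Fin n → ℝ) p q r (C ^ n) := by
  induction n with
  | zero =>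
    intro f g _ _
    rw [lnorm_fin_zero hr0, lnorm_fin_zero hp, lnorm_fin_zero hq,
      nconv_fin_zero, pow_zero, one_mul]
  | succ n ih =>
    rw [pow_succ']
    exact (h.prod hp hq hr0 hr ih).of_equiv (MeasurableEquiv.piFinSuccAbove (fun _ => ℝ) 0)
      (volume_preserving_piFinSuccAbove (fun _ => ℝ) 0) (fun _ _ => rfl)

/-! ### The endpoint where one exponent is one -/

section Endpoint

theorem lnorm_comp_sub_right {α : Type*} [MeasureSpace α] [AddCommGroup α] [MeasurableAdd α]
    [(volume : Measure α).IsAddLeftInvariant] (p : ℝ) {f : α → ℝ≥0∞} (hf : Measurable f) (y : α) :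
    lnorm p (fun x => f (x - y)) = lnorm p f :=
  lnorm_comp (measurePreserving_sub_right volume y) hf

variable {α : Type*} [MeasureSpace α] [AddCommGroup α] [MeasurableAdd₂ α] [MeasurableNeg α]
  [(volume : Measure α).IsAddLeftInvariant]

theorem nconv_comm [(volume : Measure α).IsNegInvariant] (f g : α → ℝ≥0∞) :
    nconv f g = nconv g f := by
  funext x
  unfold nconv
  rw [← lintegral_sub_left_eq_self _ x]
  simp [mul_comm]

theorem LYoung.comm [(volume : Measure α).IsNegInvariant] {p q r : ℝ} {C : ℝ≥0∞}
    (h : LYoung α p q r C) : LYoung α q p r C := by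
  intro f g hf hg
  rw [nconv_comm f g, mul_comm (lnorm q f)]
  exact h g f hg hf

theorem LYoungReverse.comm [(volume : Measure α).IsNegInvariant] {p q r : ℝ} {C : ℝ≥0∞}
    (h : LYoungReverse α p q r C) : LYoungReverse α q p r C := by
  intro f g hf hg
  rw [nconv_comm f g, mul_comm (lnorm q f)]
  exact h g f hg hf

variable [SigmaFinite (volume : Measure α)]

/-- The convolution is a superposition of translates of `g` with weights `f y`, and translates have
the same norm, so Minkowski gives constant one. -/
theorem lYoung_one {r : ℝ} (hr : 1 ≤ r) : LYoung α 1 r r 1 := by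
  intro f g hf hg
  refine (lnorm_lintegral_le hr (φ := fun z : α × α => f z.1 * g (z.2 - z.1))
    (by fun_prop)).trans_eq ?_
  change ∫⁻ y, lnorm r (fun x => f y * g (x - y)) = _
  have h (y : α) : lnorm r (fun x => f y * g (x - y)) = f y * lnorm r g := by
    rw [lnorm_const_mul (zero_lt_one.trans_le hr) _ (f := fun x => g (x - y)) (by fun_prop),
      lnorm_comp_sub_right r hg]
  simp_rw [h]
  rw [lintegral_mul_const _ hf, one_mul]
  simp [lnorm]

theorem lYoungReverse_one {r : ℝ} (hr0 : 0 < r) (hr : r ≤ 1) : LYoungReverse α 1 r r 1 := by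
  intro f g hf hg
  refine le_trans (le_of_eq ?_) (lintegral_lnorm_le hr0 hr
    (φ := fun z : α × α => f z.1 * g (z.2 - z.1)) (by fun_prop))
  change _ = ∫⁻ y, lnorm r (fun x => f y * g (x - y))
  have h (y : α) : lnorm r (fun x => f y * g (x - y)) = f y * lnorm r g := by
    rw [lnorm_const_mul hr0 _ (f := fun x => g (x - y)) (by fun_prop),
      lnorm_comp_sub_right r hg]
  simp_rw [h]
  rw [lintegral_mul_const _ hf, one_mul]
  simp [lnorm]

end Endpoint

/-! ### Monotone transport on the line -/

section Quantile

open ProbabilityTheory Set Filter Topology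

theorem continuous_cdf (μ : Measure ℝ) [IsProbabilityMeasure μ] [NullSingletonClass μ] :
    Continuous (cdf μ) := by
  refine continuous_iff_continuousAt.2 fun x => ?_
  rw [(monotone_cdf μ).continuousAt_iff_leftLim_eq_rightLim, (cdf μ).rightLim_eq]
  have h := (cdf μ).measure_singleton x
  rw [measure_cdf, measure_singleton] at h
  have := ENNReal.ofReal_eq_zero.1 h.symm
  exact le_antisymm ((monotone_cdf μ).leftLim_le le_rfl) (by linarith)

/-- The distribution function of an atomless measure is uniformly distributed: being continuous, it
has closed half-lines as nonempty sublevel sets for `t < 1`, and takes the value `t` at their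
endpoints. -/
theorem measure_cdf_le (μ : Measure ℝ) [IsProbabilityMeasure μ] [NullSingletonClass μ] {t : ℝ} (ht0 : 0 ≤ t)
    (ht1 : t ≤ 1) : μ {x | cdf μ x ≤ t} = ENNReal.ofReal t := by
  rcases ht1.eq_or_lt with rfl | ht1
  · simp [cdf_le_one]
  set T := {x | cdf μ x ≤ t} with hT
  have hc := continuous_cdf μ
  rcases T.eq_empty_or_nonempty with h | h
  · rw [h, measure_empty, eq_comm, ENNReal.ofReal_eq_zero]
    refine ge_of_tendsto' (tendsto_cdf_atBot μ) fun x => ?_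
    by_contra! hx
    exact (h ▸ (show x ∈ T from hx.le) : x ∈ (∅ : Set ℝ))
  · obtain ⟨b, hb⟩ := ((tendsto_cdf_atTop μ).eventually (lt_mem_nhds ht1)).exists
    have hbdd : BddAbove T := ⟨b, fun x hx => by
      by_contra! hxb
      exact absurd ((monotone_cdf μ hxb.le).trans hx) (not_le.2 hb)⟩
    have hmem : sSup T ∈ T := (isClosed_le hc continuous_const).csSup_mem h hbdd
    have hTI : T = Iic (sSup T) :=
      Subset.antisymm (fun x hx => le_csSup hbdd hx) fun x hx => (monotone_cdf μ hx).trans hmem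
    have heq : cdf μ (sSup T) = t := by
      refine le_antisymm hmem (ge_of_tendsto (hc.continuousWithinAt (s := Ioi (sSup T)))
        (eventually_mem_nhdsWithin.mono fun x hx => ?_))
      by_contra! hlt
      exact absurd (le_csSup hbdd (show x ∈ T from hlt.le)) (not_le.2 hx)
    rw [hTI, ← ofReal_cdf, heq]

theorem ae_cdf_mem_Ioo (μ : Measure ℝ) [IsProbabilityMeasure μ] [NullSingletonClass μ] :
    ∀ᵐ x ∂μ, cdf μ x ∈ Ioo (0 : ℝ) 1 := by
  have h0 : ∀ᵐ x ∂μ, 0 < cdf μ x := by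
    rw [ae_iff]
    simpa using measure_cdf_le μ le_rfl zero_le_one
  have h1 : ∀ᵐ x ∂μ, cdf μ x < 1 := by
    have hm : MeasurableSet {x | cdf μ x < 1} :=
      measurableSet_lt (continuous_cdf μ).measurable measurable_const
    rw [ae_iff_prob_eq_one (measurableSet_setOfPred.1 hm)]
    refine le_antisymm prob_le_one (le_of_forall_lt fun c hc => ?_)
    obtain ⟨t, rfl⟩ : ∃ t : NNReal, c = t := ⟨_, (ENNReal.coe_toNNReal hc.ne_top).symm⟩
    obtain ⟨s, hts, hs1⟩ := exists_between (ENNReal.coe_lt_one_iff.1 hc)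
    calc (t : ℝ≥0∞) < s := ENNReal.coe_lt_coe.2 hts
      _ = ENNReal.ofReal s := by simp
      _ = μ {x | cdf μ x ≤ s} := (measure_cdf_le μ s.2 (by exact_mod_cast hs1.le)).symm
      _ ≤ _ := measure_mono fun x (hx : cdf μ x ≤ s) =>
          lt_of_le_of_lt hx (by exact_mod_cast hs1)
  filter_upwards [h0, h1] with x hx0 hx1 using ⟨hx0, hx1⟩

theorem ae_hasDerivAt_cdf_withDensity {μ : Measure ℝ} [IsProbabilityMeasure μ] {F : ℝ → ℝ≥0∞} (hF : Measurable F)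
    (hμ : μ = volume.withDensity F) : ∀ᵐ x, HasDerivAt (cdf μ) (F x).toReal x := by
  have h := (cdf μ).ae_hasDerivAt
  rw [measure_cdf] at h
  filter_upwards [h, hμ ▸ Measure.rnDeriv_withDensity volume hF] with x hx hx'
  rwa [hx'] at hx

/-- The increasing rearrangement of the probability measure `μ` onto `ν`, set to zero where the
distribution function of `μ` is `0` or `1`. -/
noncomputable def rearrangement (μ ν : Measure ℝ) (x : ℝ) : ℝ :=
  {x | cdf μ x ∈ Ioo (0 : ℝ) 1}.indicator (fun x => sInf {y | cdf μ x ≤ cdf ν y}) x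

/-- Continuity of `cdf ν` makes the infimum attained. This adjunction between quantile and
distribution function yields monotonicity, measurability and the image measure. -/
theorem rearrangement_le_iff {μ ν : Measure ℝ} [IsProbabilityMeasure ν] [NullSingletonClass ν] {x : ℝ} (hx : cdf μ x ∈ Ioo (0 : ℝ) 1) (y : ℝ) :
    rearrangement μ ν x ≤ y ↔ cdf μ x ≤ cdf ν y := by
  rw [rearrangement, indicator_of_mem (by exact hx)]
  have hne : {y | cdf μ x ≤ cdf ν y}.Nonempty :=
    (((tendsto_cdf_atTop ν).eventually (lt_mem_nhds hx.2)).exists).imp fun _ h => le_of_lt h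
  obtain ⟨b, hb⟩ := ((tendsto_cdf_atBot ν).eventually (gt_mem_nhds hx.1)).exists
  have hbdd : BddBelow {y | cdf μ x ≤ cdf ν y} := ⟨b, fun z hz => by
    by_contra! hzb
    exact absurd (le_trans hz (monotone_cdf ν hzb.le)) (not_le.2 hb)⟩
  have hmem : sInf {y | cdf μ x ≤ cdf ν y} ∈ {y | cdf μ x ≤ cdf ν y} :=
    (isClosed_le continuous_const (continuous_cdf ν)).csInf_mem hne hbdd
  exact ⟨fun h => le_trans hmem (monotone_cdf ν h), fun h => csInf_le hbdd h⟩

theorem cdf_rearrangement {μ ν : Measure ℝ} [IsProbabilityMeasure ν] [NullSingletonClass ν] {x : ℝ} (hx : cdf μ x ∈ Ioo (0 : ℝ) 1) :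
    cdf ν (rearrangement μ ν x) = cdf μ x := by
  refine le_antisymm ?_ ((rearrangement_le_iff hx _).1 le_rfl)
  obtain ⟨a, ha⟩ := ((tendsto_cdf_atBot ν).eventually (gt_mem_nhds hx.1)).exists
  obtain ⟨b, hb⟩ := ((tendsto_cdf_atTop ν).eventually (lt_mem_nhds hx.2)).exists
  obtain ⟨y, hy⟩ := mem_range_of_exists_le_of_exists_ge (continuous_cdf ν) ⟨a, ha.le⟩ ⟨b, hb.le⟩
  rw [← hy]
  exact monotone_cdf ν ((rearrangement_le_iff hx y).2 hy.ge)

theorem monotoneOn_rearrangement {μ ν : Measure ℝ} [IsProbabilityMeasure ν]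
    [NullSingletonClass ν] :
    MonotoneOn (rearrangement μ ν) {x | cdf μ x ∈ Ioo (0 : ℝ) 1} := fun x hx y hy hxy => by
  rw [rearrangement_le_iff hx, cdf_rearrangement hy]
  exact monotone_cdf μ hxy

variable {μ ν : Measure ℝ} [IsProbabilityMeasure μ] [IsProbabilityMeasure ν] [NullSingletonClass μ]
  [NullSingletonClass ν]

theorem measurable_rearrangement : Measurable (rearrangement μ ν) := by
  have hI : MeasurableSet {x | cdf μ x ∈ Ioo (0 : ℝ) 1} :=
    (continuous_cdf μ).measurable measurableSet_Ioo
  refine measurable_of_Iic fun y => ?_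
  have h : rearrangement μ ν ⁻¹' Iic y =
      ({x | cdf μ x ∈ Ioo (0 : ℝ) 1} ∩ {x | cdf μ x ≤ cdf ν y}) ∪
        ({x | cdf μ x ∈ Ioo (0 : ℝ) 1}ᶜ ∩ {_x | 0 ≤ y}) := by
    ext x
    by_cases hx : cdf μ x ∈ Ioo (0 : ℝ) 1
    · simp only [mem_preimage, mem_Iic, rearrangement_le_iff hx, mem_union, mem_inter_iff,
        mem_ofPred_eq, mem_compl_iff, hx, not_true, true_and, false_and, or_false]
    · have h0 : rearrangement μ ν x = 0 := indicator_of_notMem (by exact hx) _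
      simp only [mem_preimage, mem_Iic, h0, mem_union, mem_inter_iff,
        mem_ofPred_eq, mem_compl_iff, hx, not_false_eq_true, true_and, false_and, false_or]
  rw [h]
  exact (hI.inter (measurableSet_le (continuous_cdf μ).measurable measurable_const)).union
    (hI.compl.inter (MeasurableSet.const _))

theorem map_rearrangement : μ.map (rearrangement μ ν) = ν := by
  have := Measure.isProbabilityMeasure_map (μ := μ)
    (measurable_rearrangement (μ := μ) (ν := ν)).aemeasurable
  refine Measure.ext_of_Iic _ _ fun y => ?_
  rw [Measure.map_apply measurable_rearrangement measurableSet_Iic, ← ofReal_cdf,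
    ← measure_cdf_le μ (cdf_nonneg ν y) (cdf_le_one ν y)]
  refine measure_congr ?_
  filter_upwards [ae_cdf_mem_Ioo μ] with x hx
  exact propext (rearrangement_le_iff hx y)

/-- A monotone map is differentiable almost everywhere, and the chain rule in `cdf ν ∘ u = cdf μ`
then forces `f(u) u' = F`. Exceptional null sets of `ν` pull back to null sets of `μ` because `u`
carries `μ` to `ν`. -/
theorem ae_hasDerivAt_rearrangement {F f : ℝ → ℝ≥0∞} (hF : Measurable F) (hf : Measurable f)
    (hμ : μ = volume.withDensity F) (hν : ν = volume.withDensity f) :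
    ∀ᵐ x ∂μ, F x ≠ 0 ∧ F x ≠ ∞ ∧ f (rearrangement μ ν x) ≠ 0 ∧ f (rearrangement μ ν x) ≠ ∞ ∧
      HasDerivAt (rearrangement μ ν) (F x / f (rearrangement μ ν x)).toReal x := by
  have hopen : IsOpen {x | cdf μ x ∈ Ioo (0 : ℝ) 1} := isOpen_Ioo.preimage (continuous_cdf μ)
  have hac : μ ≪ volume := hμ ▸ withDensity_absolutelyContinuous _ _
  have key {m : Measure ℝ} [IsProbabilityMeasure m] [NullSingletonClass m] {G : ℝ → ℝ≥0∞} (hG : Measurable G)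
      (hm : m = volume.withDensity G) :
      ∀ᵐ y ∂m, G y ≠ 0 ∧ G y ≠ ∞ ∧ HasDerivAt (cdf m) (G y).toReal y := by
    have hac : m ≪ volume := hm ▸ withDensity_absolutelyContinuous _ _
    have h1 : ∫⁻ x, G x ≠ ∞ := by
      have := measure_univ (μ := m)
      rw [hm, withDensity_apply _ MeasurableSet.univ, Measure.restrict_univ] at this
      simp [this]
    have h0 : ∀ᵐ y ∂m, G y ≠ 0 := by
      rw [hm, ae_withDensity_iff hG]
      exact Eventually.of_forall fun _ h => h
    filter_upwards [h0, hac.ae_le (ae_lt_top hG h1),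
      hac.ae_le (ae_hasDerivAt_cdf_withDensity hG hm)] with y h0 h1 h2 using ⟨h0, h1.ne, h2⟩
  have hpull : ∀ᵐ x ∂μ, f (rearrangement μ ν x) ≠ 0 ∧ f (rearrangement μ ν x) ≠ ∞ ∧
      HasDerivAt (cdf ν) (f (rearrangement μ ν x)).toReal (rearrangement μ ν x) := by
    have h : ∀ᵐ y ∂μ.map (rearrangement μ ν),
        f y ≠ 0 ∧ f y ≠ ∞ ∧ HasDerivAt (cdf ν) (f y).toReal y := by
      rw [map_rearrangement]
      exact key hf hν
    exact ae_of_ae_map measurable_rearrangement.aemeasurable h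
  filter_upwards [key hF hμ, hpull, ae_cdf_mem_Ioo μ,
    hac.ae_le (monotoneOn_rearrangement (μ := μ) (ν := ν)).ae_differentiableWithinAt_of_mem]
    with x ⟨hF0, hFt, hFd⟩ ⟨hf0, hft, hfd⟩ hx hdiff
  refine ⟨hF0, hFt, hf0, hft, ?_⟩
  have hd := ((hdiff hx).differentiableAt (hopen.mem_nhds hx)).hasDerivAt
  have heq : cdf ν ∘ rearrangement μ ν =ᶠ[𝓝 x] cdf μ := by
    filter_upwards [hopen.mem_nhds hx] with z hz using cdf_rearrangement hz
  have huniq := ((hfd.comp x hd).congr_of_eventuallyEq heq.symm).unique hFd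
  rwa [ENNReal.toReal_div, ← huniq, mul_div_cancel_left₀ _ (ENNReal.toReal_ne_zero.2 ⟨hf0, hft⟩)]

end Quantile

/-- Discarding a measurable null set makes the derivative formula hold at every point of `S`, as the
change of variables along lines needs, without altering the image measure. -/
theorem exists_transport_of_lintegral_eq_one {F f : ℝ → ℝ≥0∞} (hF : Measurable F)
    (hf : Measurable f) (hF1 : ∫⁻ x, F x = 1) (hf1 : ∫⁻ x, f x = 1) :
    ∃ (u : ℝ → ℝ) (S : Set ℝ), Measurable u ∧ MeasurableSet S ∧ MonotoneOn u S ∧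
      (∀ x ∈ S, F x ≠ 0 ∧ F x ≠ ∞ ∧ f (u x) ≠ 0 ∧ f (u x) ≠ ∞ ∧
        HasDerivAt u (F x / f (u x)).toReal x) ∧
      ((volume.withDensity F).restrict S).map u = volume.withDensity f := by
  set μ := volume.withDensity F with hμ
  set ν := volume.withDensity f with hν
  have : IsProbabilityMeasure μ := ⟨by rw [hμ, withDensity_apply _ MeasurableSet.univ]; simpa⟩
  have : IsProbabilityMeasure ν := ⟨by rw [hν, withDensity_apply _ MeasurableSet.univ]; simpa⟩
  have hae := (ae_hasDerivAt_rearrangement hF hf hμ hν).and (ae_cdf_mem_Ioo μ)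
  obtain ⟨T, hTsub, hTm, hT0⟩ := exists_measurable_superset_of_null (mem_ae_iff.1 hae)
  have hS {x : ℝ} (hx : x ∈ Tᶜ) := Set.compl_subset_comm.1 hTsub hx
  refine ⟨rearrangement μ ν, Tᶜ, measurable_rearrangement, hTm.compl,
    monotoneOn_rearrangement.mono fun x hx => (hS hx).2, fun x hx => (hS hx).1, ?_⟩
  rw [Measure.restrict_eq_self_of_ae_mem (s := Tᶜ) (compl_mem_ae_iff.2 hT0),
    map_rearrangement]

/-- Monotone transport between two densities of the same finite mass. -/
theorem exists_transport {F f : ℝ → ℝ≥0∞} {A : ℝ≥0∞} (hA0 : A ≠ 0) (hA : A ≠ ∞)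
    (hF : Measurable F) (hf : Measurable f) (hFA : ∫⁻ x, F x = A) (hfA : ∫⁻ x, f x = A) :
    ∃ (u : ℝ → ℝ) (S : Set ℝ), Measurable u ∧ MeasurableSet S ∧ MonotoneOn u S ∧
      (∀ x ∈ S, F x ≠ 0 ∧ F x ≠ ∞ ∧ f (u x) ≠ 0 ∧ f (u x) ≠ ∞ ∧
        HasDerivAt u (F x / f (u x)).toReal x) ∧
      ((volume.withDensity F).restrict S).map u = volume.withDensity f := by
  have hA0' : A⁻¹ ≠ 0 := ENNReal.inv_ne_zero.2 hA
  have hA' : A⁻¹ ≠ ∞ := ENNReal.inv_ne_top.2 hA0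
  have hscale {g : ℝ → ℝ≥0∞} (hg : Measurable g) (hgA : ∫⁻ x, g x = A) :
      ∫⁻ x, (A⁻¹ • g) x = 1 := by
    simp_rw [Pi.smul_apply, smul_eq_mul]
    rw [lintegral_const_mul _ hg, hgA, ENNReal.inv_mul_cancel hA0 hA]
  obtain ⟨u, S, hu, hS, hmono, hprop, hmap⟩ := exists_transport_of_lintegral_eq_one
    (hF.const_smul A⁻¹) (hf.const_smul A⁻¹) (hscale hF hFA) (hscale hf hfA)
  refine ⟨u, S, hu, hS, hmono, fun x hx => ?_, ?_⟩
  · simpa [hA0, hA, ENNReal.mul_eq_top, ENNReal.mul_div_mul_left _ _ hA0' hA'] using hprop x hx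
  · rw [withDensity_smul _ hF, withDensity_smul _ hf, Measure.restrict_smul,
      Measure.map_smul] at hmap
    have := congrArg (A • ·) hmap
    simpa [smul_smul, ENNReal.mul_inv_cancel hA0 hA] using this

/-! ### Barthe's transport inequality -/

theorem lintegral_lintegral_shear {Ψ : ℝ × ℝ → ℝ≥0∞} (hΨ : Measurable Ψ) (l : ℝ) :
    ∫⁻ a, ∫⁻ b, Ψ (a, b) = ∫⁻ σ, ∫⁻ t, Ψ (l * t + σ, (1 - l) * t - σ) := by
  -- Here `t = a + b` and `σ = a - l t`, a substitution of determinant `±1`, carried out as two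
  -- translations.
  calc ∫⁻ a, ∫⁻ b, Ψ (a, b) = ∫⁻ a, ∫⁻ t, Ψ (a, t - a) := by
        refine lintegral_congr fun a => ?_
        exact (lintegral_sub_right_eq_self (fun b => Ψ (a, b)) a).symm
    _ = ∫⁻ t, ∫⁻ a, Ψ (a, t - a) :=
        lintegral_lintegral_swap (Measurable.aemeasurable (by fun_prop))
    _ = ∫⁻ t, ∫⁻ σ, Ψ (l * t + σ, (1 - l) * t - σ) := by
        refine lintegral_congr fun t => ?_
        rw [← lintegral_add_left_eq_self _ (l * t)]
        refine lintegral_congr fun σ => ?_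
        ring_nf
    _ = _ := lintegral_lintegral_swap (Measurable.aemeasurable (by fun_prop))

theorem rpow_mul_rpow_le_ofReal {x y : ℝ≥0∞} (hx : x ≠ ∞) (hy : y ≠ ∞) {l : ℝ} (h0 : 0 ≤ l)
    (h1 : l ≤ 1) :
    x ^ l * y ^ (1 - l) ≤ ENNReal.ofReal (l * x.toReal + (1 - l) * y.toReal) := by
  rw [← ENNReal.ofReal_toReal hx, ← ENNReal.ofReal_toReal hy,
    ENNReal.ofReal_rpow_of_nonneg ENNReal.toReal_nonneg h0,
    ENNReal.ofReal_rpow_of_nonneg ENNReal.toReal_nonneg (by linarith),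
    ← ENNReal.ofReal_mul (by positivity), ENNReal.toReal_ofReal ENNReal.toReal_nonneg,
    ENNReal.toReal_ofReal ENNReal.toReal_nonneg]
  exact ENNReal.ofReal_le_ofReal (Real.geom_mean_le_arith_mean2_weighted h0 (by linarith)
    ENNReal.toReal_nonneg ENNReal.toReal_nonneg (by ring))

theorem lintegral_withDensity_withDensity {f g : ℝ → ℝ≥0∞} (hf : Measurable f) (hg : Measurable g)
    {Φ : ℝ × ℝ → ℝ≥0∞} (hΦ : Measurable Φ) :
    ∫⁻ a, ∫⁻ b, Φ (a, b) ∂volume.withDensity g ∂volume.withDensity f =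
      ∫⁻ a, ∫⁻ b, f a * g b * Φ (a, b) := by
  have : SFinite (volume.withDensity g) := inferInstance
  rw [lintegral_withDensity_eq_lintegral_mul _ hf hΦ.lintegral_prod_right']
  refine lintegral_congr fun a => ?_
  rw [Pi.mul_apply, lintegral_withDensity_eq_lintegral_mul _ hg (by fun_prop),
    ← lintegral_const_mul _ (by fun_prop)]
  simp_rw [Pi.mul_apply, mul_assoc]

/-- The estimate for one fixed `σ`. The conditions on `l` say exactly that raising `u'^(1 - 1/p)
v'^(1 - 1/q)` to the power `s` gives the weighted geometric mean `u'^l v'^(1-l)`. -/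
theorem lintegral_along_line_le {p q r s l : ℝ} (hrs : r.HolderConjugate s) (hl0 : 0 ≤ l)
    (hl1 : l ≤ 1) (hpl : (1 - 1 / p) * s = l) (hql : (1 - 1 / q) * s = 1 - l)
    {F G f g H : ℝ → ℝ≥0∞} (hF : Measurable F) (hG : Measurable G) (hf : Measurable f)
    (hg : Measurable g) (hH : Measurable H) {u v : ℝ → ℝ} {S T : Set ℝ} (hu : Measurable u)
    (hv : Measurable v) (hS : MeasurableSet S) (hT : MeasurableSet T) (huS : MonotoneOn u S)
    (hvT : MonotoneOn v T)
    (hSp : ∀ x ∈ S, F x ≠ 0 ∧ F x ≠ ∞ ∧ f (u x) ≠ 0 ∧ f (u x) ≠ ∞ ∧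
      HasDerivAt u (F x / f (u x)).toReal x)
    (hTp : ∀ x ∈ T, G x ≠ 0 ∧ G x ≠ ∞ ∧ g (v x) ≠ 0 ∧ g (v x) ≠ ∞ ∧
      HasDerivAt v (G x / g (v x)).toReal x) (σ : ℝ) :
    ∫⁻ t, S.indicator F (l * t + σ) * T.indicator G ((1 - l) * t - σ) *
        (f (u (l * t + σ)) ^ (1 / p - 1) * g (v ((1 - l) * t - σ)) ^ (1 / q - 1) *
          H (u (l * t + σ) + v ((1 - l) * t - σ))) ≤
      lnorm r (fun t => F (l * t + σ) ^ (1 / p) * G ((1 - l) * t - σ) ^ (1 / q)) * lnorm s H := by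
  set a : ℝ → ℝ := fun t => l * t + σ with ha
  set b : ℝ → ℝ := fun t => (1 - l) * t - σ with hb
  have ham : Measurable a := by fun_prop
  have hbm : Measurable b := by fun_prop
  set R : Set ℝ := a ⁻¹' S ∩ b ⁻¹' T with hR
  have hRm : MeasurableSet R := (ham hS).inter (hbm hT)
  set φ : ℝ → ℝ := fun t => u (a t) + v (b t) with hφ
  set d : ℝ → ℝ≥0∞ := fun t => F (a t) / f (u (a t)) with hd
  set e : ℝ → ℝ≥0∞ := fun t => G (b t) / g (v (b t)) with he
  have hdm : Measurable d := (hF.comp ham).div (hf.comp (hu.comp ham))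
  have hem : Measurable e := (hG.comp hbm).div (hg.comp (hv.comp hbm))
  have hφm : Measurable φ := (hu.comp ham).add (hv.comp hbm)
  set Y : ℝ → ℝ≥0∞ := R.indicator fun t =>
    d t ^ (1 - 1 / p) * e t ^ (1 - 1 / q) * H (φ t) with hY
  have hYm : Measurable Y := by
    refine Measurable.indicator ?_ hRm
    exact ((hdm.pow_const _).mul (hem.pow_const _)).mul (hH.comp hφm)
  -- With `x = F`, `y = f(u)` and `c = 1 / p`, this isolates `F ^ (1 / p)` from a power of `u' = F /
  -- f(u)`.
  have hsplit {x y : ℝ≥0∞} (hx0 : x ≠ 0) (hx : x ≠ ∞) (hy0 : y ≠ 0) (hy : y ≠ ∞) (c : ℝ) :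
      x * y ^ (c - 1) = x ^ c * (x / y) ^ (1 - c) := by
    have hxx : x = x ^ c * x ^ (1 - c) := by
      rw [← ENNReal.rpow_add _ _ hx0 hx]; simp
    rw [div_eq_mul_inv, ENNReal.mul_rpow_of_ne_top hx (ENNReal.inv_ne_top.2 hy0), ← mul_assoc,
      ← hxx, ENNReal.inv_rpow, ← ENNReal.rpow_neg]
    ring_nf
  have hpt : ∀ t, S.indicator F (a t) * T.indicator G (b t) *
        (f (u (a t)) ^ (1 / p - 1) * g (v (b t)) ^ (1 / q - 1) * H (φ t)) =
      (F (a t) ^ (1 / p) * G (b t) ^ (1 / q)) * Y t := by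
    intro t
    by_cases ht : t ∈ R
    · obtain ⟨h1, h2, h3, h4, -⟩ := hSp _ ht.1
      obtain ⟨k1, k2, k3, k4, -⟩ := hTp _ ht.2
      rw [hY, Set.indicator_of_mem ht, Set.indicator_of_mem (by exact ht.1),
        Set.indicator_of_mem (by exact ht.2)]
      calc _ = (F (a t) * f (u (a t)) ^ (1 / p - 1)) * (G (b t) * g (v (b t)) ^ (1 / q - 1)) *
            H (φ t) := by ring
        _ = _ := by
          rw [hsplit h1 h2 h3 h4, hsplit k1 k2 k3 k4]
          ring
    · rw [hY, Set.indicator_of_notMem ht, mul_zero]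
      by_cases h1 : a t ∈ S
      · have h2 : b t ∉ T := fun h => ht ⟨h1, h⟩
        rw [Set.indicator_of_notMem h2]; simp
      · rw [Set.indicator_of_notMem h1]; simp
  have hs := hrs.symm.pos
  have hYH : lnorm s Y ≤ lnorm s H := by
    unfold lnorm
    gcongr ?_ ^ _
    have hder : ∀ t ∈ R, HasDerivWithinAt φ (l * (d t).toReal + (1 - l) * (e t).toReal) R t := by
      intro t ht
      have h1 := (hSp _ ht.1).2.2.2.2
      have h2 := (hTp _ ht.2).2.2.2.2
      have ha' : HasDerivAt a l t := by
        have := ((hasDerivAt_id t).const_mul l).add_const σ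
        rwa [mul_one] at this
      have hb' : HasDerivAt b (1 - l) t := by
        have := ((hasDerivAt_id t).const_mul (1 - l)).sub_const σ
        rwa [mul_one] at this
      have := ((h1.comp t ha').add (h2.comp t hb')).hasDerivWithinAt (s := R)
      rw [mul_comm l, mul_comm (1 - l)]
      exact this
    have hmono : MonotoneOn φ R := by
      intro x hx y hy hxy
      refine add_le_add (huS hx.1 hy.1 ?_) (hvT hx.2 hy.2 ?_)
      · simp only [ha]; gcongr
      · have : 0 ≤ 1 - l := by linarith
        simp only [hb]; gcongr
    calc ∫⁻ t, Y t ^ s = ∫⁻ t in R, d t ^ l * e t ^ (1 - l) * H (φ t) ^ s := by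
          rw [← lintegral_indicator hRm]
          refine lintegral_congr fun t => ?_
          by_cases ht : t ∈ R
          · rw [hY, Set.indicator_of_mem ht, Set.indicator_of_mem ht,
              ENNReal.mul_rpow_of_nonneg _ _ hs.le, ENNReal.mul_rpow_of_nonneg _ _ hs.le,
              ← ENNReal.rpow_mul, ← ENNReal.rpow_mul, hpl, hql]
          · rw [hY, Set.indicator_of_notMem ht, Set.indicator_of_notMem ht,
              ENNReal.zero_rpow_of_pos hs]
      _ ≤ ∫⁻ t in R, ENNReal.ofReal (l * (d t).toReal + (1 - l) * (e t).toReal) * H (φ t) ^ s := by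
          refine setLIntegral_mono' hRm fun t ht => ?_
          obtain ⟨-, h2, h3, -, -⟩ := hSp _ ht.1
          obtain ⟨-, k2, k3, -, -⟩ := hTp _ ht.2
          gcongr
          exact rpow_mul_rpow_le_ofReal (ENNReal.div_ne_top h2 h3) (ENNReal.div_ne_top k2 k3)
            hl0 hl1
      _ = ∫⁻ x in φ '' R, H x ^ s :=
          (lintegral_image_eq_lintegral_deriv_mul_of_monotoneOn hRm hder hmono
            fun x => H x ^ s).symm
      -- The image of `R` need not be the whole line; only this inequality is needed.
      _ ≤ ∫⁻ x, H x ^ s := setLIntegral_le_lintegral _ _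
  refine (lintegral_congr hpt).trans_le ?_
  refine (lintegral_mul_le_lnorm_mul_lnorm hrs ?_ hYm).trans (by gcongr)
  exact ((hF.comp ham).pow_const _).mul ((hG.comp hbm).pow_const _)

/-- Barthe's inequality, comparing Young's inequality for one pair of densities with the reverse
inequality for another pair with the same masses. -/
theorem lintegral_le_of_transport {p q r s l : ℝ} (hp : 0 < p) (hq : 0 < q)
    (hrs : r.HolderConjugate s) (hl0 : 0 ≤ l)
    (hl1 : l ≤ 1) (hpl : (1 - 1 / p) * s = l) (hql : (1 - 1 / q) * s = 1 - l)
    {F G f g H : ℝ → ℝ≥0∞} (hF : Measurable F) (hG : Measurable G) (hf : Measurable f)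
    (hg : Measurable g) (hH : Measurable H) {A B : ℝ≥0∞} (hA0 : A ≠ 0) (hA : A ≠ ∞) (hB0 : B ≠ 0)
    (hB : B ≠ ∞) (hFA : ∫⁻ x, F x = A) (hfA : ∫⁻ x, f x = A) (hGB : ∫⁻ x, G x = B)
    (hgB : ∫⁻ x, g x = B) :
    ∫⁻ a, ∫⁻ b, f a ^ (1 / p) * g b ^ (1 / q) * H (a + b) ≤
      (∫⁻ σ, lnorm r fun t => F (l * t + σ) ^ (1 / p) * G ((1 - l) * t - σ) ^ (1 / q)) *
        lnorm s H := by
  obtain ⟨u, S, hu, hS, huS, hSp, humap⟩ := exists_transport hA0 hA hF hf hFA hfA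
  obtain ⟨v, T, hv, hT, hvT, hTp, hvmap⟩ := exists_transport hB0 hB hG hg hGB hgB
  rw [restrict_withDensity hS, ← withDensity_indicator hS] at humap
  rw [restrict_withDensity hT, ← withDensity_indicator hT] at hvmap
  -- One factor `f` is split off to serve as the density being transported; at `x = 0` the
  -- convention `0 * ∞ = 0` keeps the identity true.
  have hsplit {x : ℝ≥0∞} (hx : x ≠ ∞) {c : ℝ} (hc : 0 < c) : x ^ c = x * x ^ (c - 1) := by
    by_cases h0 : x = 0
    · simp [h0, hc]
    · nth_rewrite 2 [← ENNReal.rpow_one x]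
      rw [← ENNReal.rpow_add _ _ h0 hx]
      simp
  set Φ : ℝ × ℝ → ℝ≥0∞ := fun z => f z.1 ^ (1 / p - 1) * g z.2 ^ (1 / q - 1) * H (z.1 + z.2)
    with hΦ
  have hΦm : Measurable Φ := by fun_prop
  have hF' : Measurable (S.indicator F) := hF.indicator hS
  have hG' : Measurable (T.indicator G) := hG.indicator hT
  calc ∫⁻ a, ∫⁻ b, f a ^ (1 / p) * g b ^ (1 / q) * H (a + b)
      = ∫⁻ a, ∫⁻ b, f a * g b * Φ (a, b) := by
        refine lintegral_congr_ae ?_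
        filter_upwards [ae_lt_top hf (hfA ▸ hA)] with a ha
        refine lintegral_congr_ae ?_
        filter_upwards [ae_lt_top hg (hgB ▸ hB)] with b hb
        rw [hsplit ha.ne (one_div_pos.2 hp), hsplit hb.ne (one_div_pos.2 hq)]
        ring
    _ = ∫⁻ a, ∫⁻ b, Φ (a, b) ∂volume.withDensity g ∂volume.withDensity f :=
        (lintegral_withDensity_withDensity hf hg hΦm).symm
    _ = ∫⁻ a, ∫⁻ b, Φ (u a, v b) ∂volume.withDensity (T.indicator G)
          ∂volume.withDensity (S.indicator F) := by
        rw [← humap, lintegral_map hΦm.lintegral_prod_right' hu]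
        refine lintegral_congr fun a => ?_
        rw [← hvmap, lintegral_map (by fun_prop) hv]
    _ = ∫⁻ a, ∫⁻ b, S.indicator F a * T.indicator G b * Φ (u a, v b) :=
        lintegral_withDensity_withDensity hF' hG' (Φ := fun z => Φ (u z.1, v z.2)) (by fun_prop)
    _ = ∫⁻ σ, ∫⁻ t, S.indicator F (l * t + σ) * T.indicator G ((1 - l) * t - σ) *
          Φ (u (l * t + σ), v ((1 - l) * t - σ)) :=
        lintegral_lintegral_shear
          (Ψ := fun z => S.indicator F z.1 * T.indicator G z.2 * Φ (u z.1, v z.2)) (by fun_prop) l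
    _ ≤ ∫⁻ σ, (lnorm r fun t => F (l * t + σ) ^ (1 / p) * G ((1 - l) * t - σ) ^ (1 / q)) *
          lnorm s H := by
        gcongr with σ
        exact lintegral_along_line_le hrs hl0 hl1 hpl hql hF hG hf hg hH hu hv hS hT huS hvT
          hSp hTp σ
    _ = _ := by
        rw [lintegral_mul_const]
        exact measurable_lnorm_left (f := fun z : ℝ × ℝ =>
          F (l * z.2 + z.1) ^ (1 / p) * G ((1 - l) * z.2 - z.1) ^ (1 / q)) (by fun_prop)

/-! ### Gaussian integrals, norms and convolutions -/

/-- The Gaussian `exp (-π b |v|²)`. -/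
noncomputable def gauss {V : Type*} [Norm V] (b : ℝ) (v : V) : ℝ≥0∞ :=
  ENNReal.ofReal (Real.exp (-(Real.pi * b) * ‖v‖ ^ 2))

section Gauss

theorem gauss_rpow {V : Type*} [Norm V] (b t : ℝ) (v : V) : gauss b v ^ t = gauss (b * t) v := by
  rw [gauss, gauss, ENNReal.ofReal_rpow_of_pos (Real.exp_pos _), ← Real.exp_mul]
  ring_nf

theorem gauss_mul_gauss {V : Type*} [Norm V] (b c : ℝ) (v : V) :
    gauss b v * gauss c v = gauss (b + c) v := by
  simp only [gauss]
  rw [← ENNReal.ofReal_mul (Real.exp_pos _).le, ← Real.exp_add]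
  ring_nf

/-- The weights `1 - l` and `l` are those for which the cross term in `t σ` cancels, so the norm in
`t` and the integral in `σ` decouple. -/
theorem gauss_line (l t σ : ℝ) :
    gauss (1 - l) (l * t + σ) * gauss l ((1 - l) * t - σ) = gauss 1 σ * gauss (l * (1 - l)) t := by
  simp only [gauss, Real.norm_eq_abs, sq_abs]
  rw [← ENNReal.ofReal_mul (Real.exp_pos _).le, ← ENNReal.ofReal_mul (Real.exp_pos _).le,
    ← Real.exp_add, ← Real.exp_add]
  ring_nf

variable {V : Type*} [NormedAddCommGroup V] [MeasurableSpace V] [BorelSpace V]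

@[fun_prop]
theorem measurable_gauss (b : ℝ) : Measurable (gauss b : V → ℝ≥0∞) := by
  unfold gauss
  fun_prop

variable [InnerProductSpace ℝ V] [FiniteDimensional ℝ V]

theorem lintegral_gauss {b : ℝ} (hb : 0 < b) :
    ∫⁻ v : V, gauss b v = ENNReal.ofReal ((b ^ (-(1 / 2) : ℝ)) ^ Module.finrank ℝ V) := by
  have hπb : 0 < Real.pi * b := mul_pos Real.pi_pos hb
  have h := GaussianFourier.integral_rexp_neg_mul_sq_norm (V := V) hπb
  have hint : Integrable fun v : V => Real.exp (-(Real.pi * b) * ‖v‖ ^ 2) := by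
    by_contra hni
    rw [integral_undef hni] at h
    have : 0 < (Real.pi / (Real.pi * b)) ^ ((Module.finrank ℝ V : ℝ) / 2) := by positivity
    exact this.ne h
  unfold gauss
  rw [← ofReal_integral_eq_lintegral_ofReal hint (ae_of_all _ fun _ => (Real.exp_pos _).le), h,
    ← Real.rpow_mul_natCast hb.le]
  congr 1
  rw [show Real.pi / (Real.pi * b) = b⁻¹ by field_simp, Real.inv_rpow hb.le,
    ← Real.rpow_neg hb.le]
  ring_nf

theorem lnorm_gauss {b p : ℝ} (hb : 0 < b) (hp : 0 < p) :
    lnorm p (gauss b : V → ℝ≥0∞) =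
      ENNReal.ofReal (((b * p) ^ (-(1 / (2 * p)))) ^ Module.finrank ℝ V) := by
  have hbp : 0 < b * p := mul_pos hb hp
  simp_rw [lnorm, gauss_rpow]
  rw [lintegral_gauss hbp, ENNReal.ofReal_rpow_of_pos (by positivity),
    ← Real.rpow_mul_natCast hbp.le, ← Real.rpow_mul_natCast hbp.le, ← Real.rpow_mul hbp.le]
  congr 2
  field_simp

/-- Completing the square in `y` around `l • x` leaves a unit Gaussian, of integral one. -/
theorem nconv_gauss (l : ℝ) :
    nconv (gauss (1 - l) : V → ℝ≥0∞) (gauss l) = gauss (l * (1 - l)) := by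
  funext x
  have h (y : V) : gauss (1 - l) y * gauss l (x - y) =
      gauss (l * (1 - l)) x * gauss 1 (y - l • x) := by
    simp only [gauss]
    rw [← ENNReal.ofReal_mul (Real.exp_pos _).le, ← ENNReal.ofReal_mul (Real.exp_pos _).le,
      ← Real.exp_add, ← Real.exp_add, norm_sub_sq_real, norm_sub_sq_real, inner_smul_right,
      norm_smul, mul_pow, real_inner_comm, Real.norm_eq_abs, sq_abs]
    ring_nf
  unfold nconv
  simp_rw [h]
  rw [lintegral_const_mul _ (by fun_prop),
    lintegral_sub_right_eq_self (fun y : V => gauss 1 y) (l • x), lintegral_gauss one_pos]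
  simp

/-- The quotient `‖f * g‖_r / (‖f‖_p ‖g‖_q)` for the one-dimensional Gaussians
`f = exp (-π (1 - l) x²)` and `g = exp (-π l x²)`. -/
noncomputable def gaussRatio (p q r l : ℝ) : ℝ :=
  (l * (1 - l) * r) ^ (-(1 / (2 * r))) /
    (((1 - l) * p) ^ (-(1 / (2 * p))) * (l * q) ^ (-(1 / (2 * q))))

theorem gaussRatio_pos {p q r l : ℝ} (hp : 0 < p) (hq : 0 < q) (hr : 0 < r) (hl0 : 0 < l)
    (hl1 : l < 1) : 0 < gaussRatio p q r l := by
  have : 0 < 1 - l := by linarith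
  unfold gaussRatio
  positivity

theorem gaussRatio_eq_mul {p q r l : ℝ} (hp : 0 < p) (hq : 0 < q) (hl0 : 0 < l)
    (hl1 : l < 1) :
    gaussRatio p q r l = (l * (1 - l) * r) ^ (-(1 / (2 * r))) *
      (((1 - l) * p) ^ (1 / (2 * p)) * (l * q) ^ (1 / (2 * q))) := by
  have hl : 0 < 1 - l := by linarith
  rw [gaussRatio, Real.rpow_neg (mul_pos hl hp).le, Real.rpow_neg (mul_pos hl0 hq).le,
    ← mul_inv, div_inv_eq_mul]

theorem lnorm_nconv_gauss {p q r l : ℝ} (hp : 0 < p) (hq : 0 < q) (hr : 0 < r) (hl0 : 0 < l)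
    (hl1 : l < 1) :
    lnorm r (gauss (l * (1 - l)) : V → ℝ≥0∞) =
      ENNReal.ofReal (gaussRatio p q r l ^ Module.finrank ℝ V) *
        (lnorm p (gauss (1 - l) : V → ℝ≥0∞) * lnorm q (gauss l : V → ℝ≥0∞)) := by
  have hl : 0 < 1 - l := by linarith
  have hR := gaussRatio_pos hp hq hr hl0 hl1
  rw [lnorm_gauss hl hp, lnorm_gauss hl0 hq, lnorm_gauss (mul_pos hl0 hl) hr,
    ← ENNReal.ofReal_mul (by positivity), ← ENNReal.ofReal_mul (by positivity), ← mul_pow,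
    ← mul_pow, gaussRatio, div_mul_cancel₀]
  positivity

end Gauss

/-! ### The sharp Young inequality on the line -/

theorem lintegral_nconv_mul {f g H : ℝ → ℝ≥0∞} (hf : Measurable f) (hg : Measurable g)
    (hH : Measurable H) :
    ∫⁻ x, nconv f g x * H x = ∫⁻ a, ∫⁻ b, f a * g b * H (a + b) := by
  calc ∫⁻ x, nconv f g x * H x = ∫⁻ x, ∫⁻ a, f a * g (x - a) * H x := by
        refine lintegral_congr fun x => ?_
        rw [nconv, lintegral_mul_const _ (by fun_prop)]
    _ = ∫⁻ a, ∫⁻ x, f a * g (x - a) * H x :=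
        lintegral_lintegral_swap (Measurable.aemeasurable (by fun_prop))
    _ = _ := by
        refine lintegral_congr fun a => ?_
        rw [← lintegral_add_left_eq_self _ a]
        simp

theorem lintegral_comp_mul_left {f : ℝ → ℝ≥0∞} (hf : Measurable f) {c : ℝ} (hc : c ≠ 0) :
    ∫⁻ x, f (c * x) = ENNReal.ofReal |c⁻¹| * ∫⁻ x, f x := by
  rw [← lintegral_map hf (measurable_const_mul c), Real.map_volume_mul_left hc,
    lintegral_smul_measure, smul_eq_mul]

theorem lnorm_eq_zero_iff {α : Type*} [MeasureSpace α] {p : ℝ} (hp : 0 < p) {f : α → ℝ≥0∞}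
    (hf : Measurable f) : lnorm p f = 0 ↔ f =ᵐ[volume] 0 := by
  rw [lnorm, ENNReal.rpow_eq_zero_iff_of_pos (by positivity),
    lintegral_eq_zero_iff (hf.pow_const p)]
  refine Filter.eventually_congr (ae_of_all _ fun x => ?_)
  simp [hp, hp.not_gt]

/-- A multiple of a Gaussian with a prescribed integral. -/
theorem lintegral_const_mul_gauss (A : ℝ≥0∞) {b : ℝ} (hb : 0 < b) :
    ∫⁻ x : ℝ, A * ENNReal.ofReal (b ^ (1 / 2 : ℝ)) * gauss b x = A := by
  rw [lintegral_const_mul _ (by fun_prop), lintegral_gauss hb, mul_assoc,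
    ← ENNReal.ofReal_mul (by positivity), Module.finrank_self, pow_one, ← Real.rpow_add hb]
  simp

theorem const_mul_gauss_rpow (A : ℝ≥0∞) {b p : ℝ} (hb : 0 < b) (hp : 0 < p) (x : ℝ) :
    (A * ENNReal.ofReal ((b * p) ^ (1 / 2 : ℝ)) * gauss (b * p) x) ^ (1 / p) =
      A ^ (1 / p) * ENNReal.ofReal ((b * p) ^ (1 / (2 * p))) * gauss b x := by
  have hbp : 0 < b * p := mul_pos hb hp
  have h1p : 0 ≤ 1 / p := by positivity
  rw [ENNReal.mul_rpow_of_nonneg _ _ h1p, ENNReal.mul_rpow_of_nonneg _ _ h1p, gauss_rpow,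
    ENNReal.ofReal_rpow_of_nonneg (by positivity) h1p, ← Real.rpow_mul hbp.le]
  congr 3
  · congr 1
    field_simp
  · field_simp

section Real

variable {p q r : ℝ}

/-- By duality it suffices to bound `∫ (f * g) H`. The transport inequality does this with Gaussian
sources of the same masses as `f ^ p` and `g ^ q`, and its right-hand side is then explicit. -/
theorem lYoung_real (hp : 1 < p) (hq : 1 < q) (hr : 1 < r) (h : 1 / p + 1 / q = 1 + 1 / r) :
    LYoung ℝ p q r (ENNReal.ofReal (gaussRatio p q r ((1 - 1 / p) / (1 - 1 / r)))) := by
  intro f g hf hg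
  have hp0 : 0 < p := by linarith
  have hq0 : 0 < q := by linarith
  have hr0 : 0 < r := by linarith
  have hp1 : 0 < 1 - 1 / p := by rw [sub_pos, div_lt_one hp0]; exact hp
  have hq1 : 0 < 1 - 1 / q := by rw [sub_pos, div_lt_one hq0]; exact hq
  have hr1 : 0 < 1 - 1 / r := by rw [sub_pos, div_lt_one hr0]; exact hr
  set l := (1 - 1 / p) / (1 - 1 / r) with hl
  have hlr : (1 - 1 / p) = l * (1 - 1 / r) := (div_mul_cancel₀ _ hr1.ne').symm
  have hlq : (1 - 1 / q) = (1 - l) * (1 - 1 / r) := by rw [sub_mul, ← hlr]; linarith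
  have hl0 : 0 < l := div_pos hp1 hr1
  have hl1 : 0 < 1 - l := by
    by_contra! hneg
    nlinarith
  set C := gaussRatio p q r l with hC
  have hCpos : 0 < C := gaussRatio_pos hp0 hq0 hr0 hl0 (by linarith)
  by_cases hfz : lnorm p f = 0
  -- Vanishing norms are treated before infinite ones, since `0 * ∞ = 0` would make the right-hand
  -- side zero.
  · have h0 : ∀ x, nconv f g x = 0 := fun x => by
      rw [nconv, lintegral_eq_zero_iff (by fun_prop)]
      filter_upwards [(lnorm_eq_zero_iff hp0 hf).1 hfz] with y hy
      simp [hy]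
    simp [lnorm, h0, hr0]
  by_cases hgz : lnorm q g = 0
  · have h0 : ∀ x, nconv g f x = 0 := fun x => by
      rw [nconv, lintegral_eq_zero_iff (by fun_prop)]
      filter_upwards [(lnorm_eq_zero_iff hq0 hg).1 hgz] with y hy
      simp [hy]
    rw [nconv_comm]
    simp [lnorm, h0, hr0]
  have hC0 : ENNReal.ofReal C ≠ 0 := by simpa using hCpos
  by_cases hft : lnorm p f = ∞
  · simp [hft, ENNReal.top_mul hgz, ENNReal.mul_top hC0]
  by_cases hgt : lnorm q g = ∞
  · simp [hgt, ENNReal.mul_top hfz, ENNReal.mul_top hC0]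
  set A := ∫⁻ x, f x ^ p with hA
  set B := ∫⁻ x, g x ^ q with hB
  have hA0 : A ≠ 0 := by
    rw [hA, ← lnorm_rpow hp0]; simp [hfz, hft]
  have hAt : A ≠ ∞ := by
    rw [hA, ← lnorm_rpow hp0]; simp [hfz, hft]
  have hB0 : B ≠ 0 := by
    rw [hB, ← lnorm_rpow hq0]; simp [hgz, hgt]
  have hBt : B ≠ ∞ := by
    rw [hB, ← lnorm_rpow hq0]; simp [hgz, hgt]
  have hrs := Real.HolderConjugate.conjExponent hr
  have hsr : (1 - 1 / r) * r.conjExponent = 1 := by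
    rw [one_div, hrs.one_sub_inv, inv_mul_cancel₀ hrs.symm.pos.ne']
  refine lnorm_le_of_forall_lintegral_mul_le hrs fun H hH => ?_
  rw [lintegral_nconv_mul hf hg hH]
  have key := lintegral_le_of_transport hp0 hq0 hrs hl0.le (by linarith) (l := l)
    (by rw [hlr, mul_assoc, hsr, mul_one]) (by rw [hlq, mul_assoc, hsr, mul_one])
    -- The variances are chosen so that `F ^ (1 / p)` and `G ^ (1 / q)` are multiples of `gauss (1 -
    -- l)` and `gauss l`, the pair in `gauss_line`.
    (F := fun x => A * ENNReal.ofReal (((1 - l) * p) ^ (1 / 2 : ℝ)) * gauss ((1 - l) * p) x)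
    (G := fun x => B * ENNReal.ofReal ((l * q) ^ (1 / 2 : ℝ)) * gauss (l * q) x)
    (f := fun x => f x ^ p) (g := fun x => g x ^ q) (H := H)
    (by fun_prop) (by fun_prop) (by fun_prop) (by fun_prop) hH hA0 hAt hB0 hBt
    (lintegral_const_mul_gauss A (mul_pos hl1 hp0)) rfl
    (lintegral_const_mul_gauss B (mul_pos hl0 hq0)) rfl
  simp only [const_mul_gauss_rpow _ hl1 hp0, const_mul_gauss_rpow _ hl0 hq0, ← ENNReal.rpow_mul,
    mul_one_div_cancel hp0.ne', mul_one_div_cancel hq0.ne', ENNReal.rpow_one] at key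
  refine key.trans_eq ?_
  congr 1
  have hline (σ t : ℝ) : A ^ (1 / p) * ENNReal.ofReal (((1 - l) * p) ^ (1 / (2 * p))) *
        gauss (1 - l) (l * t + σ) * (B ^ (1 / q) * ENNReal.ofReal ((l * q) ^ (1 / (2 * q))) *
          gauss l ((1 - l) * t - σ)) =
      (lnorm p f * ENNReal.ofReal (((1 - l) * p) ^ (1 / (2 * p))) *
        (lnorm q g * ENNReal.ofReal ((l * q) ^ (1 / (2 * q))))) *
          (gauss 1 σ * gauss (l * (1 - l)) t) := by
    rw [← gauss_line, lnorm, lnorm]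
    ring
  simp_rw [hline]
  have hinner (σ : ℝ) (c : ℝ≥0∞) : lnorm r (fun t : ℝ => c * (gauss 1 σ * gauss (l * (1 - l)) t)) =
      c * lnorm r (fun t : ℝ => gauss (l * (1 - l)) t) * gauss 1 σ := by
    rw [lnorm_const_mul hr0 _ (by fun_prop), lnorm_const_mul hr0 _ (by fun_prop)]
    ring
  simp_rw [hinner]
  rw [lintegral_const_mul _ (by fun_prop), lintegral_gauss one_pos,
    lnorm_gauss (mul_pos hl0 hl1) hr0, hC,
    gaussRatio_eq_mul hp0 hq0 hl0 (by linarith), Module.finrank_self, pow_one, pow_one, ENNReal.ofReal_mul (by positivity), ENNReal.ofReal_mul (by positivity),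
    Real.one_rpow, ENNReal.ofReal_one]
  ring

end Real

/-! ### The sharp reverse inequality on the line -/

theorem exists_le_lt_lnorm {α : Type*} [MeasureSpace α] [SigmaFinite (volume : Measure α)] {p : ℝ}
    (hp : 0 < p) (f : α → ℝ≥0∞) {c : ℝ≥0∞} (hc : c < lnorm p f) :
    ∃ g : α → ℝ≥0∞, Measurable g ∧ (∀ x, g x ≤ f x) ∧ lnorm p g ≠ ∞ ∧ c < lnorm p g := by
  rw [lnorm, one_div, ENNReal.lt_rpow_inv_iff hp] at hc
  obtain ⟨g, hg, hle, hfin, hlt⟩ := exists_le_lt_lintegral _ hc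
  have hint : ∫⁻ x, (g x ^ (1 / p)) ^ p = ∫⁻ x, g x := by
    simp_rw [← ENNReal.rpow_mul, one_div_mul_cancel hp.ne', ENNReal.rpow_one]
  refine ⟨fun x => g x ^ (1 / p), hg.pow_const _, fun x => ?_, ?_, ?_⟩
  · rw [one_div, ENNReal.rpow_inv_le_iff hp]
    exact hle x
  · rw [lnorm, hint]
    exact ENNReal.rpow_ne_top_of_nonneg (by positivity) hfin.ne
  · rw [lnorm, hint, one_div, ENNReal.lt_rpow_inv_iff hp]
    exact hlt

/-- Transport requires finite masses. Unlike in Young's inequality, infinite norms are not trivial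
here, so functions are approximated from below, which only decreases the convolution. -/
theorem lYoungReverse_of_ne_top {α : Type*} [MeasureSpace α] [AddGroup α]
    [SigmaFinite (volume : Measure α)] {p q r : ℝ} (hp : 0 < p) (hq : 0 < q) (hr : 0 < r)
    {C : ℝ≥0∞} (hC0 : C ≠ 0) (hC : C ≠ ∞)
    (h : ∀ f g : α → ℝ≥0∞, Measurable f → Measurable g → lnorm p f ≠ ∞ → lnorm q g ≠ ∞ →
      C * (lnorm p f * lnorm q g) ≤ lnorm r (nconv f g)) : LYoungReverse α p q r C := by
  intro f g _ _
  rw [mul_comm C, ← ENNReal.le_div_iff_mul_le (Or.inl hC0) (Or.inl hC)]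
  refine ENNReal.mul_le_of_forall_lt fun a ha b hb => ?_
  obtain ⟨φ, hφ, hφf, hφt, haφ⟩ := exists_le_lt_lnorm hp f ha
  obtain ⟨ψ, hψ, hψg, hψt, hbψ⟩ := exists_le_lt_lnorm hq g hb
  refine (mul_le_mul' haφ.le hbψ.le).trans ?_
  rw [ENNReal.le_div_iff_mul_le (Or.inl hC0) (Or.inl hC), mul_comm _ C]
  refine (h φ ψ hφ hψ hφt hψt).trans (lnorm_mono hr fun x => ?_)
  unfold nconv
  gcongr with y
  · exact hφf y
  · exact hψg _

/-- Along the lines of Barthe's inequality, the integrals of a product are values of a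
convolution. -/
theorem lintegral_lnorm_line {r l : ℝ} (hr : 0 < r) (hl0 : 0 < l) (hl1 : l < 1)
    {φ ψ : ℝ → ℝ≥0∞} (hφ : Measurable φ) (hψ : Measurable ψ) :
    ∫⁻ σ, lnorm (1 / r) (fun t => φ (l * t + σ) ^ r *
        ψ (-(l / (1 - l)) * ((1 - l) * t - σ)) ^ r) =
      ENNReal.ofReal (l⁻¹ ^ r * (1 - l)) * ∫⁻ x, nconv φ ψ x ^ r := by
  have hl : 0 < 1 - l := by linarith
  have hin (σ : ℝ) : lnorm (1 / r) (fun t => φ (l * t + σ) ^ r *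
        ψ (-(l / (1 - l)) * ((1 - l) * t - σ)) ^ r) =
      ENNReal.ofReal (l⁻¹ ^ r) * nconv φ ψ ((1 - l)⁻¹ * σ) ^ r := by
    have h1 : ∫⁻ t, φ (l * t + σ) * ψ (-(l / (1 - l)) * ((1 - l) * t - σ)) =
        ENNReal.ofReal l⁻¹ * nconv φ ψ ((1 - l)⁻¹ * σ) := by
      calc ∫⁻ t, φ (l * t + σ) * ψ (-(l / (1 - l)) * ((1 - l) * t - σ))
          = ∫⁻ t, (fun a => φ (a + σ) * ψ ((1 - l)⁻¹ * σ - (a + σ))) (l * t) := by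
            refine lintegral_congr fun t => ?_
            have : -(l / (1 - l)) * ((1 - l) * t - σ) = (1 - l)⁻¹ * σ - (l * t + σ) := by
              field_simp
              ring
            rw [this]
        _ = ENNReal.ofReal |l⁻¹| * ∫⁻ a, φ (a + σ) * ψ ((1 - l)⁻¹ * σ - (a + σ)) :=
            lintegral_comp_mul_left
              (f := fun a => φ (a + σ) * ψ ((1 - l)⁻¹ * σ - (a + σ))) (by fun_prop) hl0.ne'
        _ = _ := by
            rw [abs_of_pos (by positivity), nconv, ← lintegral_add_right_eq_self
              (fun a => φ a * ψ ((1 - l)⁻¹ * σ - a)) σ]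
    unfold lnorm
    simp_rw [ENNReal.mul_rpow_of_nonneg _ _ (one_div_pos.2 hr).le, ← ENNReal.rpow_mul,
      mul_one_div_cancel hr.ne', ENNReal.rpow_one]
    rw [h1, one_div_one_div, ENNReal.mul_rpow_of_nonneg _ _ hr.le,
      ENNReal.ofReal_rpow_of_nonneg (by positivity) hr.le]
  simp_rw [hin]
  have hm := measurable_nconv hφ hψ
  rw [lintegral_const_mul _ (by fun_prop),
    lintegral_comp_mul_left (f := fun x => nconv φ ψ x ^ r) (by fun_prop) (inv_ne_zero hl.ne'),
    inv_inv, abs_of_pos hl, ← mul_assoc, ← ENNReal.ofReal_mul (by positivity)]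

/-- Matches the constants in `lYoungReverse_real`: on the left those from the Gaussian targets and
the rescaling of `ψ`, on the right the Jacobians of `lintegral_lnorm_line`. After taking logarithms
and eliminating `1 / r` it is a polynomial identity. -/
theorem gaussRatio_duality {p q r l : ℝ} (hp : 0 < p) (hq : 0 < q) (hr : 0 < r)
    (h : 1 / p + 1 / q = 1 + 1 / r) (hl0 : 0 < l) (hl1 : l < 1) :
    ((1 - l) * (p / r)) ^ (1 / (2 * p)) * (l * (q / r)) ^ (1 / (2 * q)) *
        (l * (1 - l) * (1 / r)) ^ (-(1 / 2) : ℝ) * ((1 - l) / l) ^ (1 / q) =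
      l⁻¹ * (1 - l) ^ (1 / r) * gaussRatio p q r (1 - l) := by
  have hl : 0 < 1 - l := by linarith
  rw [gaussRatio_eq_mul hp hq hl (by linarith), sub_sub_cancel]
  refine Real.log_injOn_pos (Set.mem_Ioi.2 (by positivity)) (Set.mem_Ioi.2 (by positivity)) ?_
  have e1 : Real.log ((1 - l) * (p / r)) = Real.log (1 - l) + (Real.log p - Real.log r) := by
    rw [Real.log_mul hl.ne' (by positivity), Real.log_div hp.ne' hr.ne']
  have e2 : Real.log (l * (q / r)) = Real.log l + (Real.log q - Real.log r) := by
    rw [Real.log_mul hl0.ne' (by positivity), Real.log_div hq.ne' hr.ne']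
  have e3 : Real.log (l * (1 - l) * (1 / r)) = Real.log l + Real.log (1 - l) - Real.log r := by
    rw [Real.log_mul (by positivity) (by positivity), Real.log_mul hl0.ne' hl.ne', one_div,
      Real.log_inv]
    ring
  have e4 : Real.log ((1 - l) / l) = Real.log (1 - l) - Real.log l :=
    Real.log_div hl.ne' hl0.ne'
  have e5 : Real.log ((1 - l) * l * r) = Real.log (1 - l) + Real.log l + Real.log r := by
    rw [Real.log_mul (by positivity) (by positivity), Real.log_mul hl.ne' hl0.ne']
  rw [Real.log_mul (by positivity) (by positivity), Real.log_mul (by positivity) (by positivity),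
    Real.log_mul (by positivity) (by positivity), Real.log_mul (by positivity) (by positivity),
    Real.log_mul (by positivity) (by positivity), Real.log_mul (by positivity) (by positivity),
    Real.log_mul (by positivity) (by positivity), Real.log_rpow (by positivity),
    Real.log_rpow (by positivity), Real.log_rpow (by positivity), Real.log_rpow (by positivity),
    Real.log_rpow (by positivity), Real.log_rpow (by positivity), Real.log_rpow (by positivity),
    Real.log_rpow (by positivity), Real.log_inv, e1, e2, e3, e4, e5, Real.log_mul hl0.ne' hp.ne',
    Real.log_mul hl.ne' hq.ne']
  have h2 (t : ℝ) : 1 / (2 * t) = 1 / 2 * (1 / t) := by rw [one_div_mul_one_div]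
  have h3 : 1 / r = 1 / p + 1 / q - 1 := by linarith
  rw [h2 p, h2 q, h2 r, h3]
  ring

/-- The exponents `p / r`, `q / r`, `1 / r` exceed one and again satisfy Young's relation. With `φ ^
p` and a rescaled `ψ ^ q` as sources, the right-hand side of the transport inequality contains `∫ (φ
* ψ) ^ r`, while Gaussian targets make the left-hand side explicit. -/
theorem lYoungReverse_real {p q r : ℝ} (hp0 : 0 < p) (hq0 : 0 < q) (hr0 : 0 < r) (hp : p < 1)
    (hq : q < 1) (hr : r < 1) (h : 1 / p + 1 / q = 1 + 1 / r) :
    LYoungReverse ℝ p q r (ENNReal.ofReal (gaussRatio p q r ((1 - 1 / p) / (1 - 1 / r)))) := by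
  have hpr : 0 < 1 - r / p := by
    have : 1 < 1 / q := (one_lt_div hq0).2 hq
    have h1 : 1 / p < 1 / r := by linarith
    rw [sub_pos, div_lt_one hp0]
    exact (one_div_lt_one_div hp0 hr0).1 h1
  have hqr : 0 < 1 - r / q := by
    have : 1 < 1 / p := (one_lt_div hp0).2 hp
    have h1 : 1 / q < 1 / r := by linarith
    rw [sub_pos, div_lt_one hq0]
    exact (one_div_lt_one_div hq0 hr0).1 h1
  have hr1 : 0 < 1 - r := by linarith
  have hsum : r / p + r / q = r + 1 := by
    have := congrArg (r * ·) h
    simp only [mul_add, mul_one_div, div_self hr0.ne', mul_one] at this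
    exact this
  set l := (1 - r / p) / (1 - r) with hl
  have hlp : 1 - r / p = l * (1 - r) := (div_mul_cancel₀ _ hr1.ne').symm
  have hlq : 1 - r / q = (1 - l) * (1 - r) := by rw [sub_mul, ← hlp]; linarith
  have hl0 : 0 < l := div_pos hpr hr1
  have hl1 : 0 < 1 - l := by
    by_contra! hneg
    nlinarith
  -- Passing to the exponents `p / r`, `q / r`, `1 / r` replaces the parameter by its complement.
  have hll : (1 - 1 / p) / (1 - 1 / r) = 1 - l := by
    have hr1' : 1 - 1 / r ≠ 0 := (sub_neg.2 ((one_lt_div hr0).2 hr)).ne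
    rw [div_eq_iff hr1', eq_comm]
    calc (1 - l) * (1 - 1 / r) = -((1 - l) * (1 - r)) / r := by field_simp; ring
      _ = -(1 - r / q) / r := by rw [hlq]
      _ = 1 - 1 / p := by
        rw [show r / q = r + 1 - r / p by linarith]
        field_simp
        ring
  rw [hll]
  set C := gaussRatio p q r (1 - l) with hC
  have hCpos : 0 < C := gaussRatio_pos hp0 hq0 hr0 hl1 (by linarith)
  refine lYoungReverse_of_ne_top hp0 hq0 hr0 (by simpa using hCpos) ENNReal.ofReal_ne_top
    fun φ ψ hφ hψ hφt hψt => ?_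
  by_cases hφz : lnorm p φ = 0
  · simp [hφz]
  by_cases hψz : lnorm q ψ = 0
  · simp [hψz]
  set A := ∫⁻ x, φ x ^ p with hA
  -- The reflection and scaling make the arguments of `φ` and `ψ` along a line add up to `σ / (1 -
  -- l)`, independent of `t`; the integral over `t` is then a convolution.
  set B := ∫⁻ x, ψ (-(l / (1 - l)) * x) ^ q with hB
  have hBψ : B = ENNReal.ofReal ((1 - l) / l) * lnorm q ψ ^ q := by
    rw [hB, lintegral_comp_mul_left (f := fun x => ψ x ^ q) (by fun_prop)
      (neg_ne_zero.2 (div_pos hl0 hl1).ne'), ← lnorm_rpow hq0, inv_neg, abs_neg, inv_div,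
      abs_of_pos (div_pos hl1 hl0)]
  have hA0 : A ≠ 0 := by
    rw [hA, ← lnorm_rpow hp0]; simp [hφz, hφt]
  have hAt : A ≠ ∞ := by
    rw [hA, ← lnorm_rpow hp0]; simp [hφz, hφt]
  have hB0 : B ≠ 0 := by
    rw [hBψ]; simpa [hψz, hψt] using div_pos hl1 hl0
  have hBt : B ≠ ∞ := by
    rw [hBψ]; simp [hψz, hψt, ENNReal.mul_eq_top]
  have hr' : 1 < 1 / r := (one_lt_div hr0).2 hr
  have hrs := Real.HolderConjugate.conjExponent hr'
  set s := (1 / r).conjExponent with hs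
  have hsr : (1 - r) * s = 1 := by
    have := hrs.one_sub_inv
    rw [one_div, inv_inv] at this
    rw [this, inv_mul_cancel₀ hrs.symm.pos.ne']
  have hpr0 : 0 < p / r := div_pos hp0 hr0
  have hqr0 : 0 < q / r := div_pos hq0 hr0
  have key := lintegral_le_of_transport hpr0 hqr0 hrs hl0.le (by linarith) (l := l)
    (by rw [one_div_div, hlp, mul_assoc, hsr, mul_one])
    (by rw [one_div_div, hlq, mul_assoc, hsr, mul_one])
    (f := fun x => A * ENNReal.ofReal (((1 - l) * (p / r)) ^ (1 / 2 : ℝ)) *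
      gauss ((1 - l) * (p / r)) x)
    (g := fun x => B * ENNReal.ofReal ((l * (q / r)) ^ (1 / 2 : ℝ)) * gauss (l * (q / r)) x)
    (F := fun x => φ x ^ p) (G := fun x => ψ (-(l / (1 - l)) * x) ^ q)
    -- The equality case of Hölder: `H` is the power `1 / r - 1` of `gauss (1 - l) * gauss l`, a
    -- convolution equal to `gauss (l * (1 - l))`.
    (H := gauss (l * (1 - l) * (1 / r - 1)))
    (by fun_prop) (by fun_prop) (by fun_prop) (by fun_prop) (by fun_prop) hA0 hAt hB0 hBt
    rfl (lintegral_const_mul_gauss A (mul_pos hl1 hpr0)) rfl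
    (lintegral_const_mul_gauss B (mul_pos hl0 hqr0))
  have hpp : p * (1 / (p / r)) = r := by field_simp
  have hqq : q * (1 / (q / r)) = r := by field_simp
  simp only [const_mul_gauss_rpow _ hl1 hpr0, const_mul_gauss_rpow _ hl0 hqr0, ← ENNReal.rpow_mul,
    hpp, hqq] at key
  rw [lintegral_lnorm_line hr0 hl0 (by linarith) hφ hψ] at key
  set I := ∫⁻ x, nconv φ ψ x ^ r with hI
  set J := ENNReal.ofReal ((l * (1 - l) * (1 / r)) ^ (-(1 / 2) : ℝ)) with hJ
  have hll0 : 0 < l * (1 - l) := mul_pos hl0 hl1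
  have hJint : ∫⁻ x : ℝ, gauss (l * (1 - l) * (1 / r)) x = J := by
    rw [lintegral_gauss (mul_pos hll0 (by positivity)), Module.finrank_self, pow_one]
  have hJ0 : J ≠ 0 := by
    rw [hJ]
    have : 0 < (l * (1 - l) * (1 / r)) ^ (-(1 / 2) : ℝ) := by positivity
    simpa using this
  have hJt : J ≠ ∞ := ENNReal.ofReal_ne_top
  have hnormH : lnorm s (gauss (l * (1 - l) * (1 / r - 1)) : ℝ → ℝ≥0∞) = J ^ (1 - r) := by
    have e : (1 / r - 1) * s = 1 / r := by
      calc (1 / r - 1) * s = (1 - r) * s / r := by field_simp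
        _ = 1 / r := by rw [hsr]
    have e' : 1 / s = 1 - r := (eq_div_of_mul_eq hrs.symm.pos.ne' hsr).symm
    simp_rw [lnorm, gauss_rpow]
    rw [mul_assoc, e, hJint, e']
  set k₁ := ENNReal.ofReal (((1 - l) * (p / r)) ^ (1 / (2 * (p / r)))) with hk₁
  set k₂ := ENNReal.ofReal ((l * (q / r)) ^ (1 / (2 * (q / r)))) with hk₂
  have hlhs : ∫⁻ a : ℝ, ∫⁻ b : ℝ, A ^ (1 / (p / r)) * k₁ * gauss (1 - l) a *
        (B ^ (1 / (q / r)) * k₂ * gauss l b) * gauss (l * (1 - l) * (1 / r - 1)) (a + b) =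
      A ^ (1 / (p / r)) * k₁ * (B ^ (1 / (q / r)) * k₂) * J := by
    have e (a b : ℝ) : A ^ (1 / (p / r)) * k₁ * gauss (1 - l) a *
        (B ^ (1 / (q / r)) * k₂ * gauss l b) * gauss (l * (1 - l) * (1 / r - 1)) (a + b) =
        A ^ (1 / (p / r)) * k₁ * (B ^ (1 / (q / r)) * k₂) *
          (gauss (1 - l) a * gauss l b * gauss (l * (1 - l) * (1 / r - 1)) (a + b)) := by ring
    simp_rw [e]
    have hin (a : ℝ) := lintegral_const_mul
      (μ := volume) (A ^ (1 / (p / r)) * k₁ * (B ^ (1 / (q / r)) * k₂)) (f := fun b : ℝ =>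
        gauss (1 - l) a * gauss l b * gauss (l * (1 - l) * (1 / r - 1)) (a + b)) (by fun_prop)
    simp_rw [hin]
    rw [lintegral_const_mul]
    · rw [← lintegral_nconv_mul (by fun_prop) (by fun_prop) (by fun_prop), nconv_gauss]
      simp_rw [gauss_mul_gauss]
      rw [← hJint]
      ring_nf
    · exact Measurable.lintegral_prod_right' (f := fun z : ℝ × ℝ =>
        gauss (1 - l) z.1 * gauss l z.2 * gauss (l * (1 - l) * (1 / r - 1)) (z.1 + z.2))
        (by fun_prop)
  rw [hlhs, hnormH] at key
  -- The left side carries `J` and the norm of `H` is `J ^ (1 - r)`; cancelling leaves `J ^ r`, so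
  -- the root of order `r` produces `J` itself.
  have key2 : A ^ (1 / (p / r)) * k₁ * (B ^ (1 / (q / r)) * k₂) * J ^ r ≤
      ENNReal.ofReal (l⁻¹ ^ r * (1 - l)) * I := by
    have hJ10 : J ^ (1 - r) ≠ 0 := by simp [ENNReal.rpow_eq_zero_iff, hJ0, hJt]
    have hJ1t : J ^ (1 - r) ≠ ∞ := ENNReal.rpow_ne_top_of_nonneg hr1.le hJt
    rw [← ENNReal.mul_le_mul_iff_left hJ10 hJ1t, mul_assoc, ← ENNReal.rpow_add _ _ hJ0 hJt]
    simpa using key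
  have key3 := ENNReal.rpow_le_rpow key2 (one_div_pos.2 hr0).le
  have hr1' : 0 ≤ 1 / r := (one_div_pos.2 hr0).le
  simp only [ENNReal.mul_rpow_of_nonneg _ _ hr1', ← ENNReal.rpow_mul,
    mul_one_div_cancel hr0.ne', ENNReal.rpow_one] at key3
  have hp3 : 1 / (p / r) * (1 / r) = 1 / p := by field_simp
  have hq3 : 1 / (q / r) * (1 / r) = 1 / q := by field_simp
  have hk₁' : k₁ ^ (1 / r) = ENNReal.ofReal (((1 - l) * (p / r)) ^ (1 / (2 * p))) := by
    rw [hk₁, ENNReal.ofReal_rpow_of_nonneg (by positivity) hr1', ← Real.rpow_mul (by positivity)]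
    congr 2
    field_simp
  have hk₂' : k₂ ^ (1 / r) = ENNReal.ofReal ((l * (q / r)) ^ (1 / (2 * q))) := by
    rw [hk₂, ENNReal.ofReal_rpow_of_nonneg (by positivity) hr1', ← Real.rpow_mul (by positivity)]
    congr 2
    field_simp
  have hD : ENNReal.ofReal (l⁻¹ ^ r * (1 - l)) ^ (1 / r) =
      ENNReal.ofReal (l⁻¹ * (1 - l) ^ (1 / r)) := by
    rw [ENNReal.ofReal_rpow_of_nonneg (by positivity) hr1', Real.mul_rpow (by positivity) hl1.le,
      ← Real.rpow_mul (by positivity), mul_one_div_cancel hr0.ne', Real.rpow_one]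
  have hBq : B ^ (1 / q) = ENNReal.ofReal (((1 - l) / l) ^ (1 / q)) * lnorm q ψ := by
    rw [hBψ, ENNReal.mul_rpow_of_nonneg _ _ (by positivity), ← ENNReal.rpow_mul,
      mul_one_div_cancel hq0.ne', ENNReal.rpow_one,
      ENNReal.ofReal_rpow_of_nonneg (by positivity) (by positivity)]
  rw [hp3, hq3, hk₁', hk₂', hD, hBq] at key3
  have hDpos : 0 < l⁻¹ * (1 - l) ^ (1 / r) := by positivity
  have hD0 : ENNReal.ofReal (l⁻¹ * (1 - l) ^ (1 / r)) ≠ 0 := by simpa using hDpos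
  rw [← ENNReal.mul_le_mul_iff_right hD0 ENNReal.ofReal_ne_top, ← mul_assoc,
    ← ENNReal.ofReal_mul hDpos.le, hC, ← gaussRatio_duality hp0 hq0 hr0 h hl0 (by linarith),
    ENNReal.ofReal_mul (by positivity), ENNReal.ofReal_mul (by positivity),
    ENNReal.ofReal_mul (by positivity), ← hJ]
  refine le_trans (le_of_eq ?_) key3
  rw [lnorm]
  ring

/-! ### Identification of the constant -/

theorem one_div_conjExponent {t : ℝ} (ht : 0 < t) : 1 / t.conjExponent = 1 - 1 / t := by
  rw [Real.conjExponent]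
  field_simp

theorem youngConst_pos {t : ℝ} (ht : 0 < t) : 0 < youngConst t := by
  rcases eq_or_ne t 1 with rfl | h1
  · rw [youngConst_one]
    exact one_pos
  · have h : 0 < |t.conjExponent| := abs_pos.2 (div_ne_zero ht.ne' (sub_ne_zero.2 h1))
    unfold youngConst
    positivity

/-- `Real.log` depends only on the absolute value, so one formula serves `t < 1`, where `1 - 1 / t`
is negative, and `t > 1`. -/
theorem log_youngConst {t : ℝ} (ht : 0 < t) (h1 : t ≠ 1) :
    Real.log (youngConst t) =
      1 / 2 * (1 / t * Real.log t + (1 - 1 / t) * Real.log (1 - 1 / t)) := by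
  have h : 0 < |t.conjExponent| := abs_pos.2 (div_ne_zero ht.ne' (sub_ne_zero.2 h1))
  have hinv : Real.log t.conjExponent = -Real.log (1 - 1 / t) := by
    rw [← one_div_conjExponent ht, one_div, Real.log_inv, neg_neg]
  rw [youngConst, Real.log_sqrt (by positivity), Real.log_div (by positivity) (by positivity),
    Real.log_rpow ht, Real.log_rpow h, Real.log_abs, hinv, one_div_conjExponent ht]
  ring

/-- At this `l` both `l` and `1 - l` are quotients of numbers `1 - 1 / t`. The logarithms of the two
sides are then the same combination of `log t` and `log (1 - 1 / t)` for `t = p, q, r`. -/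
theorem gaussRatio_eq_youngConst {p q r : ℝ} (hp : 0 < p) (hq : 0 < q) (hr : 0 < r)
    (h : 1 / p + 1 / q = 1 + 1 / r) (hp1 : p ≠ 1) (hq1 : q ≠ 1) (hr1 : r ≠ 1)
    (hl : (1 - 1 / p) / (1 - 1 / r) ∈ Set.Ioo (0 : ℝ) 1) :
    gaussRatio p q r ((1 - 1 / p) / (1 - 1 / r)) =
      youngConst p * youngConst q / youngConst r := by
  have hne {t : ℝ} (ht1 : t ≠ 1) : 1 - 1 / t ≠ 0 := by
    rw [sub_ne_zero, ne_comm, one_div]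
    exact inv_ne_one.2 ht1
  have hl1 : 0 < 1 - (1 - 1 / p) / (1 - 1 / r) := sub_pos.2 hl.2
  have hl' : 1 - (1 - 1 / p) / (1 - 1 / r) = (1 - 1 / q) / (1 - 1 / r) := by
    rw [one_sub_div (hne hr1)]
    congr 1
    linarith
  have hP := youngConst_pos hp
  have hQ := youngConst_pos hq
  have hR := youngConst_pos hr
  have hl0 := hl.1
  refine Real.log_injOn_pos (Set.mem_Ioi.2 (gaussRatio_pos hp hq hr hl.1 hl.2))
    (Set.mem_Ioi.2 (by positivity)) ?_
  rw [Real.log_div (by positivity) hR.ne', Real.log_mul hP.ne' hQ.ne', log_youngConst hp hp1,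
    log_youngConst hq hq1, log_youngConst hr hr1, gaussRatio_eq_mul hp hq hl.1 hl.2,
    Real.log_mul (by positivity) (by positivity), Real.log_mul (by positivity) (by positivity),
    Real.log_rpow (by positivity), Real.log_rpow (by positivity), Real.log_rpow (by positivity),
    Real.log_mul (by positivity) hr.ne', Real.log_mul hl0.ne' hl1.ne', Real.log_mul hl1.ne' hp.ne',
    Real.log_mul hl0.ne' hq.ne', hl', Real.log_div (hne hp1) (hne hr1),
    Real.log_div (hne hq1) (hne hr1)]
  have h2 (t : ℝ) : 1 / (2 * t) = 1 / 2 * (1 / t) := by rw [one_div_mul_one_div]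
  generalize Real.log (1 - 1 / p) = a
  generalize Real.log (1 - 1 / q) = b
  generalize Real.log (1 - 1 / r) = c
  have h3 : 1 / r = 1 / p + 1 / q - 1 := by linarith
  rw [h2 p, h2 q, h2 r, h3]
  ring

/-- The exponents are all on the same side of one. -/
def SameSide (p q r : ℝ) : Prop :=
  (1 ≤ p ∧ 1 ≤ q ∧ 1 ≤ r) ∨ (p ≤ 1 ∧ q ≤ 1 ∧ r ≤ 1)

theorem one_div_sub_lt_one {p q r : ℝ} (hp : 0 < p) (hq : 0 < q) (hr : 0 < r)
    (h : 1 / p + 1 / q = 1 + 1 / r) (hs : SameSide p q r) (hp1 : p ≠ 1) (hq1 : q ≠ 1) :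
    r ≠ 1 ∧ (1 - 1 / p) / (1 - 1 / r) ∈ Set.Ioo (0 : ℝ) 1 := by
  rcases hs with ⟨h1, h2, h3⟩ | ⟨h1, h2, h3⟩
  · have hp' : 1 / p < 1 := (div_lt_one hp).2 (lt_of_le_of_ne h1 hp1.symm)
    have hq' : 1 / q < 1 := (div_lt_one hq).2 (lt_of_le_of_ne h2 hq1.symm)
    have hr' : 0 < 1 - 1 / r := by linarith
    refine ⟨?_, div_pos (by linarith) hr', (div_lt_one hr').2 (by linarith)⟩
    rintro rfl
    norm_num at hr'
  · have hp' : 1 < 1 / p := (one_lt_div hp).2 (lt_of_le_of_ne h1 hp1)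
    have hq' : 1 < 1 / q := (one_lt_div hq).2 (lt_of_le_of_ne h2 hq1)
    have hr' : 1 - 1 / r < 0 := by linarith
    refine ⟨?_, div_pos_of_neg_of_neg (by linarith) hr', (div_lt_one_of_neg hr').2 (by linarith)⟩
    rintro rfl
    norm_num at hr'

theorem eq_of_one_div_add {q r : ℝ} (h : 1 / (1 : ℝ) + 1 / q = 1 + 1 / r) : q = r := by
  simpa using h

/-! ### The sharp inequalities with endpoints, on the line and in Euclidean space -/

theorem lYoung_real_sharp {p q r : ℝ} (hp : 1 ≤ p) (hq : 1 ≤ q) (hr : 1 ≤ r)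
    (h : 1 / p + 1 / q = 1 + 1 / r) :
    LYoung ℝ p q r (ENNReal.ofReal (youngConst p * youngConst q / youngConst r)) := by
  have hp0 : 0 < p := by linarith
  have hq0 : 0 < q := by linarith
  have hr0 : 0 < r := by linarith
  have hC := (youngConst_pos hr0).ne'
  by_cases hp1 : p = 1
  · subst hp1
    obtain rfl := eq_of_one_div_add h
    rw [youngConst_one, one_mul, div_self hC, ENNReal.ofReal_one]
    exact lYoung_one hr
  by_cases hq1 : q = 1
  · subst hq1
    obtain rfl := eq_of_one_div_add ((add_comm _ _).trans h)
    rw [youngConst_one, mul_one, div_self hC, ENNReal.ofReal_one]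
    exact (lYoung_one hr).comm
  obtain ⟨hr1, hl⟩ := one_div_sub_lt_one hp0 hq0 hr0 h (Or.inl ⟨hp, hq, hr⟩) hp1 hq1
  rw [← gaussRatio_eq_youngConst hp0 hq0 hr0 h hp1 hq1 hr1 hl]
  exact lYoung_real (lt_of_le_of_ne hp (Ne.symm hp1)) (lt_of_le_of_ne hq (Ne.symm hq1))
    (lt_of_le_of_ne hr (Ne.symm hr1)) h

theorem lYoungReverse_real_sharp {p q r : ℝ} (hp0 : 0 < p) (hq0 : 0 < q) (hr0 : 0 < r)
    (hp : p ≤ 1) (hq : q ≤ 1) (hr : r ≤ 1) (h : 1 / p + 1 / q = 1 + 1 / r) :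
    LYoungReverse ℝ p q r (ENNReal.ofReal (youngConst p * youngConst q / youngConst r)) := by
  have hC := (youngConst_pos hr0).ne'
  by_cases hp1 : p = 1
  · subst hp1
    obtain rfl := eq_of_one_div_add h
    rw [youngConst_one, one_mul, div_self hC, ENNReal.ofReal_one]
    exact lYoungReverse_one hr0 hr
  by_cases hq1 : q = 1
  · subst hq1
    obtain rfl := eq_of_one_div_add ((add_comm _ _).trans h)
    rw [youngConst_one, mul_one, div_self hC, ENNReal.ofReal_one]
    exact (lYoungReverse_one hr0 hr).comm
  obtain ⟨hr1, hl⟩ := one_div_sub_lt_one hp0 hq0 hr0 h (Or.inr ⟨hp, hq, hr⟩) hp1 hq1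
  rw [← gaussRatio_eq_youngConst hp0 hq0 hr0 h hp1 hq1 hr1 hl]
  exact lYoungReverse_real hp0 hq0 hr0 (lt_of_le_of_ne hp hp1) (lt_of_le_of_ne hq hq1)
    (lt_of_le_of_ne hr hr1) h

theorem sharpYoungConst_eq_pow {p q r : ℝ} (hp : 0 < p) (hq : 0 < q) (hr : 0 < r) (N : ℕ) :
    sharpYoungConst N p q r =
      ENNReal.ofReal (youngConst p * youngConst q / youngConst r) ^ N := by
  have hP := youngConst_pos hp
  have hQ := youngConst_pos hq
  have hR := youngConst_pos hr
  rw [sharpYoungConst, ENNReal.ofReal_pow (by positivity)]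

theorem lYoung_euclidean {p q r : ℝ} (hp : 1 ≤ p) (hq : 1 ≤ q) (hr : 1 ≤ r)
    (h : 1 / p + 1 / q = 1 + 1 / r) (N : ℕ) :
    LYoung (EuclideanSpace ℝ (Fin N)) p q r (sharpYoungConst N p q r) := by
  have hp0 : 0 < p := by linarith
  have hq0 : 0 < q := by linarith
  rw [sharpYoungConst_eq_pow hp0 hq0 (by linarith)]
  exact ((lYoung_real_sharp hp hq hr h).pi hp0 hq0 hr N).of_equiv
    (MeasurableEquiv.toLp 2 (Fin N → ℝ)).symm
    (EuclideanSpace.volume_preserving_symm_measurableEquiv_toLp (Fin N)) fun _ _ => rfl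

theorem lYoungReverse_euclidean {p q r : ℝ} (hp0 : 0 < p) (hq0 : 0 < q) (hr0 : 0 < r)
    (hp : p ≤ 1) (hq : q ≤ 1) (hr : r ≤ 1) (h : 1 / p + 1 / q = 1 + 1 / r) (N : ℕ) :
    LYoungReverse (EuclideanSpace ℝ (Fin N)) p q r (sharpYoungConst N p q r) := by
  rw [sharpYoungConst_eq_pow hp0 hq0 hr0]
  exact ((lYoungReverse_real_sharp hp0 hq0 hr0 hp hq hr h).pi hp0 hq0 hr0 hr N).of_equiv
    (MeasurableEquiv.toLp 2 (Fin N → ℝ)).symm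
    (EuclideanSpace.volume_preserving_symm_measurableEquiv_toLp (Fin N)) fun _ _ => rfl

/-! ### Passage to real-valued functions in `L^p` -/

theorem eLpNorm_eq_lnorm {α : Type*} [MeasureSpace α] {p : ℝ} (hp : 0 < p) (f : α → ℝ≥0∞) :
    eLpNorm f (ENNReal.ofReal p) volume = lnorm p f := by
  rw [eLpNorm_eq_lintegral_rpow_enorm_toReal (by simpa using hp) ENNReal.ofReal_ne_top,
    ENNReal.toReal_ofReal hp.le]
  rfl

theorem eLpNorm_eq_lnorm_of_ae_eq {α : Type*} [MeasureSpace α] {p : ℝ} (hp : 0 < p) {f : α → ℝ}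
    {F : α → ℝ≥0∞} (hf : ∀ᵐ x, 0 ≤ f x) (hF : ∀ᵐ x, ENNReal.ofReal (f x) = F x) :
    eLpNorm f (ENNReal.ofReal p) volume = lnorm p F := by
  rw [eLpNorm_eq_lintegral_rpow_enorm_toReal (by simpa using hp) ENNReal.ofReal_ne_top,
    ENNReal.toReal_ofReal hp.le, lnorm]
  congr 1
  refine lintegral_congr_ae ?_
  filter_upwards [hf, hF] with x hx hx'
  rw [← hx', Real.enorm_of_nonneg hx]

theorem nonnegConv_eq_nconv {N : ℕ} {f g : EuclideanSpace ℝ (Fin N) → ℝ}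
    {F G : EuclideanSpace ℝ (Fin N) → ℝ≥0∞} (hF : ∀ᵐ x, ENNReal.ofReal (f x) = F x)
    (hG : ∀ᵐ x, ENNReal.ofReal (g x) = G x) : nonnegConv f g = nconv F G := by
  funext x
  refine lintegral_congr_ae ?_
  have hG' : ∀ᵐ y, ENNReal.ofReal (g (x - y)) = G (x - y) :=
    (quasiMeasurePreserving_sub_left volume x).ae hG
  filter_upwards [hF, hG'] with y hy hy'
  rw [hy, hy']

theorem exists_measurable_ofReal_eq {α : Type*} [MeasureSpace α] {p : ℝ≥0∞} {f : α → ℝ}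
    (hf : MemLp f p volume) :
    ∃ F : α → ℝ≥0∞, Measurable F ∧ ∀ᵐ x, ENNReal.ofReal (f x) = F x :=
  have h := hf.aestronglyMeasurable.aemeasurable.ennreal_ofReal
  ⟨h.mk _, h.measurable_mk, h.ae_eq_mk⟩

theorem LYoung.youngIneq {N : ℕ} {p q r : ℝ} (hp : 0 < p) (hq : 0 < q) (hr : 0 < r) {K : ℝ≥0∞}
    (h : LYoung (EuclideanSpace ℝ (Fin N)) p q r K) : YoungIneq N p q r K := by
  intro f g hf hg hf0 hg0
  obtain ⟨F, hFm, hF⟩ := exists_measurable_ofReal_eq hf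
  obtain ⟨G, hGm, hG⟩ := exists_measurable_ofReal_eq hg
  rw [nonnegConv_eq_nconv hF hG, eLpNorm_eq_lnorm hr, eLpNorm_eq_lnorm_of_ae_eq hp hf0 hF,
    eLpNorm_eq_lnorm_of_ae_eq hq hg0 hG]
  exact h F G hFm hGm

theorem LYoungReverse.reverseYoungIneq {N : ℕ} {p q r : ℝ} (hp : 0 < p) (hq : 0 < q) (hr : 0 < r)
    {K : ℝ≥0∞} (h : LYoungReverse (EuclideanSpace ℝ (Fin N)) p q r K) :
    ReverseYoungIneq N p q r K := by
  intro f g hf hg hf0 hg0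
  obtain ⟨F, hFm, hF⟩ := exists_measurable_ofReal_eq hf
  obtain ⟨G, hGm, hG⟩ := exists_measurable_ofReal_eq hg
  rw [nonnegConv_eq_nconv hF hG, eLpNorm_eq_lnorm hr, eLpNorm_eq_lnorm_of_ae_eq hp hf0 hF,
    eLpNorm_eq_lnorm_of_ae_eq hq hg0 hG]
  exact h F G hFm hGm

/-! ### Optimality of the constants -/

section Optimality

open Filter Topology

variable {N : ℕ} {p q r l : ℝ}

theorem lnorm_gauss_ne_zero_ne_top (N : ℕ) {b p : ℝ} (hb : 0 < b) (hp : 0 < p) :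
    lnorm p (gauss b : EuclideanSpace ℝ (Fin N) → ℝ≥0∞) ≠ 0 ∧
      lnorm p (gauss b : EuclideanSpace ℝ (Fin N) → ℝ≥0∞) ≠ ∞ := by
  rw [lnorm_gauss hb hp]
  refine ⟨?_, ENNReal.ofReal_ne_top⟩
  rw [Ne, ENNReal.ofReal_eq_zero, not_le]
  have := mul_pos hb hp
  positivity

theorem memLp_exp_neg_mul_sq (N : ℕ) {b p : ℝ} (hb : 0 < b) (hp : 0 < p) :
    MemLp (fun x : EuclideanSpace ℝ (Fin N) => Real.exp (-(Real.pi * b) * ‖x‖ ^ 2))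
      (ENNReal.ofReal p) volume := by
  refine ⟨(by fun_prop : Continuous _).aestronglyMeasurable, ?_⟩
  rw [eLpNorm_eq_lnorm_of_ae_eq hp (ae_of_all _ fun _ => (Real.exp_pos _).le)
    (ae_of_all _ fun _ => rfl)]
  exact (lnorm_gauss_ne_zero_ne_top N hb hp).2.lt_top

/-- The parameter `l` is left free, so that at the endpoints, where no `l` in the open interval is
prescribed, a limit can be taken. -/
theorem YoungIneq.gaussRatio_le {K : ℝ≥0∞} (hK : YoungIneq N p q r K) (hp : 0 < p) (hq : 0 < q)
    (hr : 0 < r) (hl : l ∈ Set.Ioo (0 : ℝ) 1) : ENNReal.ofReal (gaussRatio p q r l ^ N) ≤ K := by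
  have hl1 : 0 < 1 - l := sub_pos.2 hl.2
  have h := hK _ _ (memLp_exp_neg_mul_sq N hl1 hp) (memLp_exp_neg_mul_sq N hl.1 hq)
    (ae_of_all _ fun _ => (Real.exp_pos _).le) (ae_of_all _ fun _ => (Real.exp_pos _).le)
  rw [nonnegConv_eq_nconv (F := gauss (1 - l)) (G := gauss l) (ae_of_all _ fun _ => rfl)
      (ae_of_all _ fun _ => rfl), eLpNorm_eq_lnorm hr,
    eLpNorm_eq_lnorm_of_ae_eq (F := gauss (1 - l)) hp (ae_of_all _ fun _ => (Real.exp_pos _).le)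
      (ae_of_all _ fun _ => rfl),
    eLpNorm_eq_lnorm_of_ae_eq (F := gauss l) hq (ae_of_all _ fun _ => (Real.exp_pos _).le)
      (ae_of_all _ fun _ => rfl), nconv_gauss, lnorm_nconv_gauss hp hq hr hl.1 hl.2,
    finrank_euclideanSpace_fin] at h
  obtain ⟨hf0, hft⟩ := lnorm_gauss_ne_zero_ne_top N hl1 hp
  obtain ⟨hg0, hgt⟩ := lnorm_gauss_ne_zero_ne_top N hl.1 hq
  exact (ENNReal.mul_le_mul_iff_left (mul_ne_zero hf0 hg0) (ENNReal.mul_ne_top hft hgt)).1 h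

theorem ReverseYoungIneq.le_gaussRatio {K : ℝ≥0∞} (hK : ReverseYoungIneq N p q r K) (hp : 0 < p)
    (hq : 0 < q) (hr : 0 < r) (hl : l ∈ Set.Ioo (0 : ℝ) 1) :
    K ≤ ENNReal.ofReal (gaussRatio p q r l ^ N) := by
  have hl1 : 0 < 1 - l := sub_pos.2 hl.2
  have h := hK _ _ (memLp_exp_neg_mul_sq N hl1 hp) (memLp_exp_neg_mul_sq N hl.1 hq)
    (ae_of_all _ fun _ => (Real.exp_pos _).le) (ae_of_all _ fun _ => (Real.exp_pos _).le)
  rw [nonnegConv_eq_nconv (F := gauss (1 - l)) (G := gauss l) (ae_of_all _ fun _ => rfl)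
      (ae_of_all _ fun _ => rfl), eLpNorm_eq_lnorm hr,
    eLpNorm_eq_lnorm_of_ae_eq (F := gauss (1 - l)) hp (ae_of_all _ fun _ => (Real.exp_pos _).le)
      (ae_of_all _ fun _ => rfl),
    eLpNorm_eq_lnorm_of_ae_eq (F := gauss l) hq (ae_of_all _ fun _ => (Real.exp_pos _).le)
      (ae_of_all _ fun _ => rfl), nconv_gauss, lnorm_nconv_gauss hp hq hr hl.1 hl.2,
    finrank_euclideanSpace_fin] at h
  obtain ⟨hf0, hft⟩ := lnorm_gauss_ne_zero_ne_top N hl1 hp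
  obtain ⟨hg0, hgt⟩ := lnorm_gauss_ne_zero_ne_top N hl.1 hq
  exact (ENNReal.mul_le_mul_iff_left (mul_ne_zero hf0 hg0) (ENNReal.mul_ne_top hft hgt)).1 h

theorem gaussRatio_comm (p q r l : ℝ) : gaussRatio q p r (1 - l) = gaussRatio p q r l := by
  rw [gaussRatio, gaussRatio, sub_sub_cancel, mul_comm (1 - l) l,
    mul_comm ((l * q) ^ (-(1 / (2 * q))))]

/-- For `p = 1` and `q = r` the powers of `l * r` cancel, and the ratio tends to the sharp value one
as `l → 0`, when `g` becomes much wider than `f`. -/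
theorem gaussRatio_one_left (hr : 0 < r) (hl : l ∈ Set.Ioo (0 : ℝ) 1) :
    gaussRatio 1 r r l = (1 - l) ^ (1 / 2 - 1 / (2 * r)) := by
  have hl0 := hl.1
  have hl1 : 0 < 1 - l := sub_pos.2 hl.2
  rw [gaussRatio_eq_mul one_pos hr hl.1 hl.2, show l * (1 - l) * r = (1 - l) * (l * r) by ring,
    Real.mul_rpow hl1.le (by positivity), sub_eq_add_neg (1 / 2 : ℝ), Real.rpow_add hl1,
    Real.rpow_neg (mul_pos hl0 hr).le]
  have : (l * r) ^ (1 / (2 * r)) ≠ 0 := by positivity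
  field_simp

theorem tendsto_gaussRatio_one_left (hr : 0 < r) :
    Tendsto (gaussRatio 1 r r) (𝓝[>] 0) (𝓝 1) := by
  have hc : ContinuousAt (fun l : ℝ => (1 - l) ^ (1 / 2 - 1 / (2 * r))) 0 :=
    (continuousAt_const.sub continuousAt_id).rpow_const (Or.inl (by simp))
  have h : Tendsto (fun l : ℝ => (1 - l) ^ (1 / 2 - 1 / (2 * r))) (𝓝[>] 0) (𝓝 1) := by
    simpa using hc.tendsto.mono_left nhdsWithin_le_nhds
  refine h.congr' ?_
  filter_upwards [Ioo_mem_nhdsGT one_pos] with l hl using (gaussRatio_one_left hr hl).symm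

/-- The sharp constant is a limit of ratios attained by Gaussians. -/
theorem exists_tendsto_gaussRatio (hp : 0 < p) (hq : 0 < q) (hr : 0 < r)
    (h : 1 / p + 1 / q = 1 + 1 / r) (hs : SameSide p q r) :
    ∃ F : Filter ℝ, F.NeBot ∧ (∀ᶠ l in F, l ∈ Set.Ioo (0 : ℝ) 1) ∧
      Tendsto (gaussRatio p q r) F (𝓝 (youngConst p * youngConst q / youngConst r)) := by
  have hC := (youngConst_pos hr).ne'
  by_cases hp1 : p = 1
  · subst hp1
    obtain rfl := eq_of_one_div_add h
    rw [youngConst_one, one_mul, div_self hC]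
    exact ⟨𝓝[>] 0, inferInstance, Ioo_mem_nhdsGT one_pos, tendsto_gaussRatio_one_left hr⟩
  by_cases hq1 : q = 1
  · subst hq1
    obtain rfl := eq_of_one_div_add ((add_comm _ _).trans h)
    rw [youngConst_one, mul_one, div_self hC]
    refine ⟨(𝓝[>] 0).map fun l => 1 - l, inferInstance, ?_, ?_⟩
    · rw [eventually_map]
      filter_upwards [Ioo_mem_nhdsGT one_pos] with l hl
      exact ⟨sub_pos.2 hl.2, by linarith [hl.1]⟩
    · rw [tendsto_map'_iff]
      exact (tendsto_gaussRatio_one_left hr).congr fun l => (gaussRatio_comm _ _ _ _).symm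
  obtain ⟨hr1, hl⟩ := one_div_sub_lt_one hp hq hr h hs hp1 hq1
  -- Away from the endpoints the constant is attained, so the filter is concentrated at a single
  -- `l`.
  refine ⟨pure ((1 - 1 / p) / (1 - 1 / r)), inferInstance, hl, ?_⟩
  rw [← gaussRatio_eq_youngConst hp hq hr h hp1 hq1 hr1 hl]
  exact tendsto_pure_nhds _ _

theorem tendsto_ofReal_pow_sharpYoungConst {F : Filter ℝ}
    (hF : Tendsto (gaussRatio p q r) F (𝓝 (youngConst p * youngConst q / youngConst r))) (N : ℕ) :
    Tendsto (fun l => ENNReal.ofReal (gaussRatio p q r l ^ N)) F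
      (𝓝 (sharpYoungConst N p q r)) :=
  (ENNReal.continuous_ofReal.tendsto _).comp (hF.pow N)

theorem YoungIneq.sharpYoungConst_le {K : ℝ≥0∞} (hK : YoungIneq N p q r K) (hp : 0 < p)
    (hq : 0 < q) (hr : 0 < r) (h : 1 / p + 1 / q = 1 + 1 / r) (hs : SameSide p q r) :
    sharpYoungConst N p q r ≤ K := by
  obtain ⟨F, hne, hmem, hF⟩ := exists_tendsto_gaussRatio hp hq hr h hs
  exact le_of_tendsto (tendsto_ofReal_pow_sharpYoungConst hF N)
    (hmem.mono fun l hl => hK.gaussRatio_le hp hq hr hl)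

theorem ReverseYoungIneq.le_sharpYoungConst {K : ℝ≥0∞} (hK : ReverseYoungIneq N p q r K)
    (hp : 0 < p) (hq : 0 < q) (hr : 0 < r) (h : 1 / p + 1 / q = 1 + 1 / r)
    (hs : SameSide p q r) : K ≤ sharpYoungConst N p q r := by
  obtain ⟨F, hne, hmem, hF⟩ := exists_tendsto_gaussRatio hp hq hr h hs
  exact ge_of_tendsto (tendsto_ofReal_pow_sharpYoungConst hF N)
    (hmem.mono fun l hl => hK.le_gaussRatio hp hq hr hl)

end Optimality

theorem theorem1 (N : ℕ) (p q r : ℝ) (hp : 0 < p) (hq : 0 < q) (hr : 0 < r)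
    (hpqr : 1 / p + 1 / q = 1 + 1 / r) :
    (1 ≤ p → 1 ≤ q → 1 ≤ r →
      YoungIneq N p q r (sharpYoungConst N p q r) ∧
        ∀ K : ENNReal, YoungIneq N p q r K → sharpYoungConst N p q r ≤ K) ∧
    (p ≤ 1 → q ≤ 1 → r ≤ 1 →
      ReverseYoungIneq N p q r (sharpYoungConst N p q r) ∧
        ∀ K : ENNReal, ReverseYoungIneq N p q r K → K ≤ sharpYoungConst N p q r) := by
  refine ⟨fun hp1 hq1 hr1 => ⟨?_, fun K hK => ?_⟩, fun hp1 hq1 hr1 => ⟨?_, fun K hK => ?_⟩⟩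
  · exact (lYoung_euclidean hp1 hq1 hr1 hpqr N).youngIneq hp hq hr
  · exact hK.sharpYoungConst_le hp hq hr hpqr (Or.inl ⟨hp1, hq1, hr1⟩)
  · exact (lYoungReverse_euclidean hp hq hr hp1 hq1 hr1 hpqr N).reverseYoungIneq hp hq hr
  · exact hK.le_sharpYoungConst hp hq hr hpqr (Or.inr ⟨hp1, hq1, hr1⟩)
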